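/- Let $a,b,d\in\mathbb R$ with $ad>0$, and let $H=L^2(0,1)\oplus\mathbb R$ be the real Hilbert space with inner product $$\big((u,u_1),(v,v_1)\big)_H=\int_0^1 uv\,dx+\frac ad\,u_1v_1 .$$ Let $H_2=\{(u,u_1)\in H^2(0,1)\oplus\mathbb R:\ u(1)=u_1,\ u(0)=0\}$, where $H^2(0,1)$ is the Sobolev space and $u(0)$, $u(1)$ and $u'(1)$ are the values of the continuous representatives on $[0,1]$ of $u$ and of its weak derivative $u'$. Let $\mathcal A$ be the operator in $H$ with domain $D(\mathcal A)=H_2$ given by $$\mathcal A(u,u_1)=\Big(u'',\,-\frac da\,u'(1)+\frac ba\,u_1\Big).$$ Then $\mathcal A$ is densely defined and self-adjoint, and it generates a compact analytic $C_0$-semigroup $(e^{t\mathcal A})_{t\ge0}$ of angle $\frac\pi2$ on $H$. That is, $\mathcal A$ is the generator of a $C_0$-semigroup on $H$, the operator $e^{t\mathcal A}$ is compact for every $t>0$, and the complex linear extension of the semigroup to the complexification $L^2(0,1;\mathbb C)\oplus\mathbb C$ of $H$ extends to an analytic semigroup $(S(z))_{z\in\Sigma\cup\{0\}}$ on $\Sigma=\{z\neq0:|\arg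 z|<\frac\pi2\}$: $S(0)=I$, $S(z+w)=S(z)S(w)$ for $z,w\in\Sigma$, $z\mapsto S(z)$ is holomorphic on $\Sigma$, and for every $0<\delta'<\frac\pi2$ and every $x$, $S(z)x\to x$ as $z\to0$ with $|\arg z|<\delta'$. -/

import Mathlib

namespace Wentzell

open MeasureTheory Set Filter Topology
open scoped ContDiff

noncomputable section

/-- The Lebesgue space `L²(0,1)` of `𝕜`-valued functions. -/
abbrev L2 (𝕜 : Type) [RCLike 𝕜] : Type :=
  Lp 𝕜 2 ((volume : Measure ℝ).restrict (Ioo 0 1))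

/-- Test functions on `(0,1)`: smooth functions with compact support in `(0,1)`. -/
structure IsTestFunction (φ : ℝ → ℝ) : Prop where
  smooth : ContDiff ℝ ∞ φ
  compact : HasCompactSupport φ
  supp : tsupport φ ⊆ Ioo 0 1

/-- `v` is the weak derivative of `u` on `(0,1)`. -/
def IsWeakDeriv (u v : L2 ℝ) : Prop :=
  ∀ φ : ℝ → ℝ, IsTestFunction φ →
    ∫ x in Ioo (0 : ℝ) 1, u x * deriv φ x = -∫ x in Ioo (0 : ℝ) 1, v x * φ x

/-- `g` is a representative of the class `u` that is continuous on `[0,1]`. -/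
def IsContRep (u : L2 ℝ) (g : ℝ → ℝ) : Prop :=
  ContinuousOn g (Icc 0 1) ∧ u =ᵐ[(volume : Measure ℝ).restrict (Ioo 0 1)] g

theorem IsTestFunction.deriv {φ : ℝ → ℝ} (h : IsTestFunction φ) : IsTestFunction (deriv φ) :=
  ⟨((contDiff_infty_iff_deriv.1 h.smooth).2), h.compact.deriv,
    (tsupport_deriv_subset (𝕜 := ℝ)).trans h.supp⟩

theorem integrable_mul_cont (u : L2 ℝ) {φ : ℝ → ℝ} (h : ContinuousOn φ (Icc 0 1)) :
    IntegrableOn (fun x => u x * φ x) (Ioo (0 : ℝ) 1) := by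
  have h1 : IntegrableOn (u : ℝ → ℝ) (Icc (0:ℝ) 1) := by
    rw [integrableOn_Icc_iff_integrableOn_Ioo]
    exact (Lp.memLp u).integrable (by norm_num)
  exact (h1.mul_continuousOn h isCompact_Icc).mono_set Ioo_subset_Icc_self

theorem IsTestFunction.continuousOn {φ : ℝ → ℝ} (h : IsTestFunction φ) :
    ContinuousOn φ (Icc 0 1) := h.smooth.continuous.continuousOn

theorem IsWeakDeriv.add {u₁ v₁ u₂ v₂ : L2 ℝ} (h₁ : IsWeakDeriv u₁ v₁) (h₂ : IsWeakDeriv u₂ v₂) :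
    IsWeakDeriv (u₁ + u₂) (v₁ + v₂) := by
  intro φ hφ
  have e (a b : L2 ℝ) {ψ : ℝ → ℝ} (hψ : IsTestFunction ψ) :
      ∫ x in Ioo (0 : ℝ) 1, (a + b : L2 ℝ) x * ψ x =
        (∫ x in Ioo (0 : ℝ) 1, a x * ψ x) + ∫ x in Ioo (0 : ℝ) 1, b x * ψ x := by
    rw [← integral_add (integrable_mul_cont a hψ.continuousOn)
      (integrable_mul_cont b hψ.continuousOn)]
    refine integral_congr_ae ?_
    filter_upwards [Lp.coeFn_add a b] with x hx
    simp only [hx, Pi.add_apply, add_mul]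
  rw [e _ _ hφ, e _ _ hφ.deriv, h₁ φ hφ, h₂ φ hφ]; ring

theorem IsWeakDeriv.smul {u v : L2 ℝ} (c : ℝ) (h : IsWeakDeriv u v) :
    IsWeakDeriv (c • u) (c • v) := by
  intro φ hφ
  have e (a : L2 ℝ) (ψ : ℝ → ℝ) :
      ∫ x in Ioo (0 : ℝ) 1, (c • a : L2 ℝ) x * ψ x = c * ∫ x in Ioo (0 : ℝ) 1, a x * ψ x := by
    rw [← integral_const_mul]
    refine integral_congr_ae ?_
    filter_upwards [Lp.coeFn_smul c a] with x hx
    simp [hx, mul_assoc]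
  rw [e, e, h φ hφ]; ring

theorem isWeakDeriv_zero : IsWeakDeriv 0 0 := by
  intro φ hφ
  have e (ψ : ℝ → ℝ) : ∫ x in Ioo (0 : ℝ) 1, (0 : L2 ℝ) x * ψ x = 0 := by
    rw [integral_eq_zero_of_ae]
    filter_upwards [Lp.coeFn_zero ℝ 2 ((volume : Measure ℝ).restrict (Ioo 0 1))] with x hx
    simp only [hx, Pi.zero_apply, zero_mul]
  rw [e, e, neg_zero]

theorem ae_zero_of_test {f : ℝ → ℝ} (hf : IntegrableOn f (Ioo 0 1))
    (h : ∀ φ, IsTestFunction φ → ∫ x in Ioo (0 : ℝ) 1, f x * φ x = 0) :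
    f =ᵐ[(volume : Measure ℝ).restrict (Ioo 0 1)] 0 := by
  have := isOpen_Ioo.ae_eq_zero_of_integral_contDiff_smul_eq_zero (μ := volume)
    (U := Ioo (0:ℝ) 1) (f := f) hf.locallyIntegrableOn (by
      intro g h1 h2 h3
      rw [← h g ⟨h1, h2, h3⟩, ← setIntegral_eq_integral_of_forall_compl_eq_zero (s := Ioo (0:ℝ) 1)]
      · simp [mul_comm]
      · intro x hx
        rw [image_eq_zero_of_notMem_tsupport (fun h => hx (h3 h)), zero_smul])
  exact (ae_restrict_iff' measurableSet_Ioo).2 this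

theorem integrableOn_L2 (u : L2 ℝ) : IntegrableOn (u : ℝ → ℝ) (Ioo 0 1) :=
  (Lp.memLp u).integrable (by norm_num)

theorem IsWeakDeriv.unique {u v₁ v₂ : L2 ℝ} (h₁ : IsWeakDeriv u v₁) (h₂ : IsWeakDeriv u v₂) :
    v₁ = v₂ := by
  have := ae_zero_of_test (f := fun x => v₁ x - v₂ x)
    ((integrableOn_L2 v₁).sub (integrableOn_L2 v₂)) (by
      intro φ hφ
      have := h₁ φ hφ
      have := h₂ φ hφ
      simp only [sub_mul]
      rw [integral_sub (integrable_mul_cont v₁ hφ.continuousOn)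
        (integrable_mul_cont v₂ hφ.continuousOn)]
      linarith)
  apply Lp.ext
  filter_upwards [this] with x hx
  simpa [sub_eq_zero] using hx

theorem IsContRep.eqOn {u : L2 ℝ} {g₁ g₂ : ℝ → ℝ} (h₁ : IsContRep u g₁) (h₂ : IsContRep u g₂) :
    EqOn g₁ g₂ (Icc 0 1) := by
  refine Measure.eqOn_Icc_of_ae_eq volume zero_ne_one ?_ h₁.1 h₂.1
  rw [restrict_Ioo_eq_restrict_Icc.symm]
  exact h₁.2.symm.trans h₂.2

theorem IsContRep.add {u₁ u₂ : L2 ℝ} {g₁ g₂ : ℝ → ℝ} (h₁ : IsContRep u₁ g₁)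
    (h₂ : IsContRep u₂ g₂) : IsContRep (u₁ + u₂) (g₁ + g₂) := by
  refine ⟨h₁.1.add h₂.1, ?_⟩
  filter_upwards [Lp.coeFn_add u₁ u₂, h₁.2, h₂.2] with x hx h1 h2
  rw [hx, Pi.add_apply, Pi.add_apply, h1, h2]

theorem IsContRep.smul {u : L2 ℝ} {g : ℝ → ℝ} (c : ℝ) (h : IsContRep u g) :
    IsContRep (c • u) (c • g) := by
  refine ⟨h.1.const_smul c, ?_⟩
  filter_upwards [Lp.coeFn_smul c u, h.2] with x hx h1
  simp [hx, h1]

/-- A test function whose integral is zero has an antiderivative that is a test function. -/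
theorem IsTestFunction.exists_antideriv {θ : ℝ → ℝ} (h : IsTestFunction θ)
    (h0 : ∫ x in (0 : ℝ)..1, θ x = 0) : ∃ φ, IsTestFunction φ ∧ _root_.deriv φ = θ := by
  have hc : Continuous θ := h.smooth.continuous
  set φ : ℝ → ℝ := fun x => ∫ t in (0 : ℝ)..x, θ t with hφ
  have hd (x : ℝ) : HasDerivAt φ (θ x) x :=
    intervalIntegral.integral_hasDerivAt_right (hc.intervalIntegrable _ _)
      (hc.stronglyMeasurableAtFilter _ _) hc.continuousAt
  have hd' : _root_.deriv φ = θ := funext fun x => (hd x).deriv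
  obtain ⟨α, β, hα, hβ, hs⟩ : ∃ α β : ℝ, 0 < α ∧ β < 1 ∧ tsupport θ ⊆ Icc α β := by
    rcases (tsupport θ).eq_empty_or_nonempty with he | hne
    · exact ⟨1/2, 1/2, by norm_num, by norm_num, by simp [he]⟩
    · have hK : IsCompact (tsupport θ) := h.compact
      exact ⟨sInf (tsupport θ), sSup (tsupport θ), (h.supp (hK.sInf_mem hne)).1,
        (h.supp (hK.sSup_mem hne)).2,
        fun x hx => ⟨csInf_le hK.bddBelow hx, le_csSup hK.bddAbove hx⟩⟩
  have hz (x : ℝ) (hx : x ∉ Icc α β) : θ x = 0 :=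
    image_eq_zero_of_notMem_tsupport fun h => hx (hs h)
  have hsub : Function.support φ ⊆ Icc α β := by
    intro x hx
    by_contra hn
    apply hx
    rcases lt_or_ge x α with hl | hl
    · refine intervalIntegral.integral_zero_ae (Eventually.of_forall fun t ht => hz t fun h' => ?_)
      have := (uIoc_subset_uIcc ht).2
      rcases le_max_iff.1 this with h1 | h1 <;> linarith [h'.1]
    · have hr : β < x := by by_contra hb; exact hn ⟨hl, not_lt.1 hb⟩
      have : (∫ t in (0 : ℝ)..1, θ t) + ∫ t in (1 : ℝ)..x, θ t = φ x :=
        intervalIntegral.integral_add_adjacent_intervals (hc.intervalIntegrable _ _)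
          (hc.intervalIntegrable _ _)
      rw [← this, h0, zero_add]
      refine intervalIntegral.integral_zero_ae (Eventually.of_forall fun t ht => hz t fun h' => ?_)
      have := (uIoc_subset_uIcc ht).1
      rcases min_le_iff.1 this with h1 | h1 <;> linarith [h'.2]
  have hts : tsupport φ ⊆ Icc α β := closure_minimal hsub isClosed_Icc
  refine ⟨φ, ⟨?_, HasCompactSupport.of_support_subset_isCompact isCompact_Icc hsub,
    hts.trans fun x hx => ⟨hα.trans_le hx.1, hx.2.trans_lt hβ⟩⟩, hd'⟩
  rw [contDiff_infty_iff_deriv, hd']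
  exact ⟨fun x => (hd x).differentiableAt, h.smooth⟩

theorem exists_unit_test : ∃ ψ, IsTestFunction ψ ∧ ∫ x in (0 : ℝ)..1, ψ x = 1 := by
  let f : ContDiffBump (1/2 : ℝ) := ⟨1/8, 1/4, by norm_num, by norm_num⟩
  have hs : tsupport (f.normed volume) ⊆ Ioo 0 1 := by
    rw [f.tsupport_normed_eq, Real.closedBall_eq_Icc]
    intro x hx
    have h1 : (1/2 : ℝ) - 1/4 ≤ x := hx.1
    have h2 : x ≤ (1/2 : ℝ) + 1/4 := hx.2
    constructor <;> linarith
  refine ⟨f.normed volume, ⟨f.contDiff_normed, f.hasCompactSupport_normed, hs⟩, ?_⟩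
  rw [intervalIntegral.integral_of_le zero_le_one, setIntegral_eq_integral_of_forall_compl_eq_zero]
  · exact f.integral_normed
  · intro x hx
    exact image_eq_zero_of_notMem_tsupport fun h => hx (Ioo_subset_Ioc_self (hs h))

theorem setInt_eq (f : ℝ → ℝ) : ∫ x in Ioo (0 : ℝ) 1, f x = ∫ x in (0 : ℝ)..1, f x := by
  rw [intervalIntegral.integral_of_le zero_le_one, integral_Ioc_eq_integral_Ioo]

theorem IsTestFunction.zero_left {φ : ℝ → ℝ} (h : IsTestFunction φ) : φ 0 = 0 :=
  image_eq_zero_of_notMem_tsupport fun h' => lt_irrefl _ (h.supp h').1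

theorem IsTestFunction.zero_right {φ : ℝ → ℝ} (h : IsTestFunction φ) : φ 1 = 0 :=
  image_eq_zero_of_notMem_tsupport fun h' => lt_irrefl _ (h.supp h').2

/-- Functions in `H¹(0,1)` have a representative that is continuous on `[0,1]`. -/
theorem IsWeakDeriv.exists_contRep {u v : L2 ℝ} (h : IsWeakDeriv u v) : ∃ g, IsContRep u g := by
  have hv : IntervalIntegrable v volume 0 1 := by
    rw [intervalIntegrable_iff_integrableOn_Ioo_of_le zero_le_one]
    exact integrableOn_L2 v
  set G : ℝ → ℝ := fun x => ∫ t in (0 : ℝ)..x, v t with hG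
  have hGac : AbsolutelyContinuousOnInterval G 0 1 :=
    hv.absolutelyContinuousOnInterval_intervalIntegral (by simp)
  have hGc : ContinuousOn G (Icc 0 1) := by
    simpa [uIcc_of_le zero_le_one] using hGac.continuousOn
  have hGd : ∀ᵐ x, x ∈ uIcc (0 : ℝ) 1 → HasDerivAt G (v x) x := by
    filter_upwards [hv.ae_hasDerivAt_integral] with x hx hx'
    exact hx hx' 0 (by simp)
  have hGi (φ : ℝ → ℝ) (hφ : IsTestFunction φ) :
      ∫ x in Ioo (0 : ℝ) 1, G x * deriv φ x = -∫ x in Ioo (0 : ℝ) 1, v x * φ x := by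
    have hφac : AbsolutelyContinuousOnInterval φ 0 1 :=
      ContDiffOn.absolutelyContinuousOnInterval (hφ.smooth.contDiffOn.of_le (by norm_cast))
    rw [setInt_eq, setInt_eq, hGac.integral_mul_deriv_eq_deriv_mul hφac, hφ.zero_left,
      hφ.zero_right]
    have : ∫ x in (0:ℝ)..1, deriv G x * φ x = ∫ x in (0:ℝ)..1, v x * φ x := by
      refine intervalIntegral.integral_congr_ae ?_
      filter_upwards [hGd] with x hx hx'
      rw [(hx (uIoc_subset_uIcc hx')).deriv]
    rw [this]; ring
  obtain ⟨ψ, hψ, hψ1⟩ := exists_unit_test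
  have hGint : IntegrableOn G (Ioo 0 1) :=
    (hGc.integrableOn_Icc).mono_set Ioo_subset_Icc_self
  have hGmul {φ : ℝ → ℝ} (hφ : IsTestFunction φ) :
      IntegrableOn (fun x => G x * φ x) (Ioo 0 1) :=
    ((hGc.mul hφ.continuousOn).integrableOn_Icc).mono_set Ioo_subset_Icc_self
  set w : ℝ → ℝ := fun x => u x - G x with hw
  have hwmul {φ : ℝ → ℝ} (hφ : IsTestFunction φ) :
      IntegrableOn (fun x => w x * φ x) (Ioo 0 1) := by
    simp only [hw, sub_mul]
    exact (integrable_mul_cont u hφ.continuousOn).sub (hGmul hφ)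
  have hwd (φ : ℝ → ℝ) (hφ : IsTestFunction φ) : ∫ x in Ioo (0 : ℝ) 1, w x * deriv φ x = 0 := by
    simp only [hw, sub_mul]
    rw [integral_sub (integrable_mul_cont u hφ.deriv.continuousOn) (hGmul hφ.deriv), h φ hφ,
      hGi φ hφ, sub_self]
  set c : ℝ := ∫ x in Ioo (0 : ℝ) 1, w x * ψ x with hc
  have key := ae_zero_of_test (f := fun x => w x - c)
    (((integrableOn_L2 u).sub hGint).sub (integrableOn_const (by simp))) (by
      intro η hη
      set I : ℝ := ∫ x in (0:ℝ)..1, η x with hI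
      have hθ : IsTestFunction (fun x => η x - I * ψ x) := by
        have hsupp : Function.support (fun x => η x - I * ψ x) ⊆ tsupport η ∪ tsupport ψ := by
          intro x hx
          by_contra hn
          rw [mem_union, not_or] at hn
          apply hx
          simp [image_eq_zero_of_notMem_tsupport hn.1, image_eq_zero_of_notMem_tsupport hn.2]
        have hcl : IsCompact (tsupport η ∪ tsupport ψ) :=
          IsCompact.union hη.compact hψ.compact
        exact ⟨hη.smooth.sub (contDiff_const.mul hψ.smooth),
          HasCompactSupport.of_support_subset_isCompact hcl hsupp,
          (closure_minimal hsupp hcl.isClosed).trans (union_subset hη.supp hψ.supp)⟩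
      obtain ⟨φ, hφ, hφd⟩ := hθ.exists_antideriv (by
        rw [intervalIntegral.integral_sub (hη.smooth.continuous.intervalIntegrable _ _)
          ((hψ.smooth.continuous.intervalIntegrable _ _).const_mul I),
          intervalIntegral.integral_const_mul, hψ1, mul_one, hI, sub_self])
      have h1 := hwd φ hφ
      rw [hφd] at h1
      have h2 : ∫ x in Ioo (0 : ℝ) 1, w x * (η x - I * ψ x) =
          (∫ x in Ioo (0 : ℝ) 1, w x * η x) - I * c := by
        rw [hc, ← integral_const_mul, ← integral_sub (hwmul hη) ((hwmul hψ).const_mul I)]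
        congr 1; ext x; ring
      have h3 : ∫ x in Ioo (0 : ℝ) 1, (w x - c) * η x =
          (∫ x in Ioo (0 : ℝ) 1, w x * η x) - c * I := by
        rw [hI, ← setInt_eq, ← integral_const_mul, ← integral_sub (hwmul hη)]
        · congr 1; ext x; ring
        · exact ((hη.smooth.continuous.integrableOn_Icc).mono_set Ioo_subset_Icc_self).const_mul c
      rw [h3]; linarith)
  refine ⟨fun x => G x + c, hGc.add continuousOn_const, ?_⟩
  filter_upwards [key] with x hx
  have : u x - G x - c = 0 := hx
  show u x = G x + c
  linarith

/-- `u ∈ H¹(0,1)`: the class `u ∈ L²(0,1)` has a weak derivative in `L²(0,1)`. -/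
def MemH1 (u : L2 ℝ) : Prop := ∃ v, IsWeakDeriv u v

/-- `u ∈ H²(0,1)`: `u ∈ L²(0,1)` has a weak derivative in `L²(0,1)`, which has one in turn. -/
def MemH2 (u : L2 ℝ) : Prop := ∃ v, IsWeakDeriv u v ∧ MemH1 v

open Classical in
/-- The weak derivative of `u ∈ H¹(0,1)` (and `0` if `u` is not in `H¹(0,1)`). -/
def weakDeriv (u : L2 ℝ) : L2 ℝ := if h : MemH1 u then h.choose else 0

open Classical in
/-- The value at `x ∈ [0,1]` of the representative of `u` that is continuous on `[0,1]`
(and `0` if there is none; every `u ∈ H¹(0,1)` has exactly one). -/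
def valueAt (u : L2 ℝ) (x : ℝ) : ℝ := if h : ∃ g, IsContRep u g then h.choose x else 0

theorem IsWeakDeriv.weakDeriv_eq {u v : L2 ℝ} (h : IsWeakDeriv u v) : weakDeriv u = v := by
  have hu : MemH1 u := ⟨v, h⟩
  rw [weakDeriv, dif_pos hu]
  exact hu.choose_spec.unique h

theorem IsContRep.valueAt_eq {u : L2 ℝ} {g : ℝ → ℝ} (h : IsContRep u g) {x : ℝ}
    (hx : x ∈ Icc (0 : ℝ) 1) : valueAt u x = g x := by
  have hu : ∃ g, IsContRep u g := ⟨g, h⟩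
  rw [valueAt, dif_pos hu]
  exact hu.choose_spec.eqOn h hx

theorem isContRep_zero : IsContRep 0 0 :=
  ⟨continuousOn_const, Lp.coeFn_zero ℝ 2 _⟩

theorem MemH1.add {u v : L2 ℝ} (hu : MemH1 u) (hv : MemH1 v) : MemH1 (u + v) :=
  ⟨_, hu.choose_spec.add hv.choose_spec⟩

theorem MemH1.smul {u : L2 ℝ} (c : ℝ) (hu : MemH1 u) : MemH1 (c • u) :=
  ⟨_, hu.choose_spec.smul c⟩

theorem MemH1.weakDeriv_add {u v : L2 ℝ} (hu : MemH1 u) (hv : MemH1 v) :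
    weakDeriv (u + v) = weakDeriv u + weakDeriv v := by
  obtain ⟨u', hu⟩ := hu
  obtain ⟨v', hv⟩ := hv
  rw [(hu.add hv).weakDeriv_eq, hu.weakDeriv_eq, hv.weakDeriv_eq]

theorem MemH1.weakDeriv_smul {u : L2 ℝ} (c : ℝ) (hu : MemH1 u) :
    weakDeriv (c • u) = c • weakDeriv u := by
  obtain ⟨u', hu⟩ := hu
  rw [(hu.smul c).weakDeriv_eq, hu.weakDeriv_eq]

theorem MemH1.valueAt_add {u v : L2 ℝ} (hu : MemH1 u) (hv : MemH1 v) {x : ℝ}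
    (hx : x ∈ Icc (0 : ℝ) 1) : valueAt (u + v) x = valueAt u x + valueAt v x := by
  obtain ⟨g, hg⟩ := hu.choose_spec.exists_contRep
  obtain ⟨k, hk⟩ := hv.choose_spec.exists_contRep
  rw [(hg.add hk).valueAt_eq hx, hg.valueAt_eq hx, hk.valueAt_eq hx, Pi.add_apply]

theorem MemH1.valueAt_smul {u : L2 ℝ} (c : ℝ) (hu : MemH1 u) {x : ℝ}
    (hx : x ∈ Icc (0 : ℝ) 1) : valueAt (c • u) x = c * valueAt u x := by
  obtain ⟨g, hg⟩ := hu.choose_spec.exists_contRep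
  rw [(hg.smul c).valueAt_eq hx, hg.valueAt_eq hx, Pi.smul_apply, smul_eq_mul]

theorem MemH2.memH1 {u : L2 ℝ} (hu : MemH2 u) : MemH1 u := ⟨_, hu.choose_spec.1⟩

theorem MemH2.memH1_weakDeriv {u : L2 ℝ} (hu : MemH2 u) : MemH1 (weakDeriv u) := by
  obtain ⟨v, hv, hv'⟩ := hu
  rwa [hv.weakDeriv_eq]

theorem MemH2.add {u v : L2 ℝ} (hu : MemH2 u) (hv : MemH2 v) : MemH2 (u + v) :=
  ⟨_, hu.choose_spec.1.add hv.choose_spec.1, hu.choose_spec.2.add hv.choose_spec.2⟩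

theorem MemH2.smul {u : L2 ℝ} (c : ℝ) (hu : MemH2 u) : MemH2 (c • u) :=
  ⟨_, hu.choose_spec.1.smul c, hu.choose_spec.2.smul c⟩

theorem memH2_zero : MemH2 0 := ⟨0, isWeakDeriv_zero, 0, isWeakDeriv_zero⟩

theorem zero_mem_Icc : (0 : ℝ) ∈ Icc (0 : ℝ) 1 := ⟨le_rfl, zero_le_one⟩

theorem one_mem_Icc : (1 : ℝ) ∈ Icc (0 : ℝ) 1 := ⟨zero_le_one, le_rfl⟩

/-! ### The Hilbert space `L²(0,1) ⊕ 𝕜` with the weighted inner product -/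

/-- Pairs `(u, u₁)` with `u ∈ L²(0,1)` and `u₁ ∈ 𝕜`; for `𝕜 = ℝ` this is the state space `H`, and
for `𝕜 = ℂ` its complexification. The parameters `a` and `d` enter through the inner product
`∫₀¹ u v dx + (a/d) u₁ v₁` (with a conjugation in one factor if `𝕜 = ℂ`). -/
structure StateSpace (a d : ℝ) (𝕜 : Type) [RCLike 𝕜] : Type where
  fst : L2 𝕜
  snd : 𝕜

namespace StateSpace

variable {a d : ℝ} {𝕜 : Type} [RCLike 𝕜]

@[ext] theorem ext_pair {U V : StateSpace a d 𝕜} (h₁ : U.fst = V.fst) (h₂ : U.snd = V.snd) :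
    U = V := by
  cases U; cases V; simp_all

/-- The underlying pair. -/
def equivProd (a d : ℝ) (𝕜 : Type) [RCLike 𝕜] : StateSpace a d 𝕜 ≃ L2 𝕜 × 𝕜 where
  toFun U := (U.fst, U.snd)
  invFun p := ⟨p.1, p.2⟩
  left_inv _ := rfl
  right_inv _ := rfl

/-- The weighted inner product. -/
instance instInner : Inner 𝕜 (StateSpace a d 𝕜) :=
  ⟨fun U V => inner 𝕜 U.fst V.fst + ((a / d : ℝ) : 𝕜) * inner 𝕜 U.snd V.snd⟩

instance : AddCommGroup (StateSpace a d 𝕜) := (equivProd a d 𝕜).addCommGroup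
instance : Module 𝕜 (StateSpace a d 𝕜) := (equivProd a d 𝕜).module 𝕜

@[simp] theorem add_fst (U V : StateSpace a d 𝕜) : (U + V).fst = U.fst + V.fst := rfl
@[simp] theorem add_snd (U V : StateSpace a d 𝕜) : (U + V).snd = U.snd + V.snd := rfl
@[simp] theorem zero_fst : (0 : StateSpace a d 𝕜).fst = 0 := rfl
@[simp] theorem zero_snd : (0 : StateSpace a d 𝕜).snd = 0 := rfl
@[simp] theorem smul_fst (c : 𝕜) (U : StateSpace a d 𝕜) : (c • U).fst = c • U.fst := rfl
@[simp] theorem smul_snd (c : 𝕜) (U : StateSpace a d 𝕜) : (c • U).snd = c * U.snd := rfl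

theorem inner_def (U V : StateSpace a d 𝕜) :
    inner 𝕜 U V = inner 𝕜 U.fst V.fst + ((a / d : ℝ) : 𝕜) * inner 𝕜 U.snd V.snd := rfl

theorem weight_pos (a d : ℝ) [had : Fact (0 < a * d)] : 0 < a / d := by
  have h := had.out
  rcases pos_and_pos_or_neg_and_neg_of_mul_pos h with ⟨h1, h2⟩ | ⟨h1, h2⟩
  · exact div_pos h1 h2
  · exact div_pos_of_neg_of_neg h1 h2

theorem re_inner_self (U : StateSpace a d 𝕜) :
    RCLike.re (inner 𝕜 U U) = ‖U.fst‖ ^ 2 + a / d * ‖U.snd‖ ^ 2 := by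
  rw [inner_def, inner_self_eq_norm_sq_to_K, inner_self_eq_norm_sq_to_K]
  norm_cast

abbrev core [Fact (0 < a * d)] : InnerProductSpace.Core 𝕜 (StateSpace a d 𝕜) where
  toInner := instInner
  conj_inner_symm U V := by
    simp only [inner_def, map_add, map_mul, inner_conj_symm, RCLike.conj_ofReal]
  re_inner_nonneg U := by
    have := weight_pos a d
    rw [re_inner_self]; positivity
  add_left U V W := by
    simp only [inner_def, add_fst, add_snd, inner_add_left]; ring
  smul_left U V c := by
    simp only [inner_def, smul_fst, smul_snd, ← smul_eq_mul (a := c), inner_smul_left]; ring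
  definite U h := by
    have hw := weight_pos a d
    have h' := re_inner_self U
    rw [h, map_zero] at h'
    have h1 : ‖U.fst‖ ^ 2 = 0 := by nlinarith [sq_nonneg ‖U.fst‖, mul_nonneg hw.le (sq_nonneg ‖U.snd‖)]
    have h2 : a / d * ‖U.snd‖ ^ 2 = 0 := by linarith
    ext1
    · simpa using h1
    · simpa [hw.ne'] using h2

variable [Fact (0 < a * d)]

instance : NormedAddCommGroup (StateSpace a d 𝕜) := (core (𝕜 := 𝕜)).toNormedAddCommGroup
instance : InnerProductSpace 𝕜 (StateSpace a d 𝕜) := InnerProductSpace.ofCore core.toCore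

theorem norm_sq_eq (U : StateSpace a d 𝕜) : ‖U‖ ^ 2 = ‖U.fst‖ ^ 2 + a / d * ‖U.snd‖ ^ 2 := by
  rw [← re_inner_self, norm_sq_eq_re_inner (𝕜 := 𝕜)]

/-- Rescaling the second component identifies the state space isometrically with the usual
(unweighted) Hilbert sum. -/
def isometryProd (a d : ℝ) (𝕜 : Type) [RCLike 𝕜] [Fact (0 < a * d)] :
    StateSpace a d 𝕜 ≃ₗᵢ[𝕜] WithLp 2 (L2 𝕜 × 𝕜) where
  toFun U := WithLp.toLp 2 (U.fst, ((√(a / d) : ℝ) : 𝕜) * U.snd)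
  invFun p := ⟨p.fst, (((√(a / d))⁻¹ : ℝ) : 𝕜) * p.snd⟩
  map_add' U V := by
    apply WithLp.ofLp_injective; ext1 <;> simp [mul_add]
  map_smul' c U := by
    apply WithLp.ofLp_injective; ext1 <;> simp [mul_left_comm]
  left_inv U := by
    have : ((√(a / d) : ℝ) : 𝕜) ≠ 0 := by
      exact_mod_cast (Real.sqrt_pos.2 (weight_pos a d)).ne'
    ext1 <;> simp [this]
  right_inv p := by
    have : ((√(a / d) : ℝ) : 𝕜) ≠ 0 := by
      exact_mod_cast (Real.sqrt_pos.2 (weight_pos a d)).ne'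
    apply WithLp.ofLp_injective; ext1 <;> simp [this]
  norm_map' U := by
    rw [← sq_eq_sq₀ (norm_nonneg _) (norm_nonneg _), norm_sq_eq]
    have := Real.sq_sqrt (weight_pos a d).le
    simp [WithLp.prod_norm_sq_eq_of_L2, mul_pow, this]

instance instCompleteSpace : CompleteSpace (StateSpace a d 𝕜) :=
  (completeSpace_congr (e := (isometryProd a d 𝕜).toEquiv) (isometryProd a d 𝕜).isometry.isUniformEmbedding).2 inferInstance

end StateSpace

/-! ### The operator -/

/-- The space `H₂` of the pairs `(u, u₁)` with `u ∈ H²(0,1)`, `u(1) = u₁` and `u(0) = 0`. -/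
def spaceH2 (a d : ℝ) [Fact (0 < a * d)] : Submodule ℝ (StateSpace a d ℝ) where
  carrier := {U | MemH2 U.fst ∧ valueAt U.fst 1 = U.snd ∧ valueAt U.fst 0 = 0}
  add_mem' := by
    rintro U V ⟨hU, hU1, hU0⟩ ⟨hV, hV1, hV0⟩
    refine ⟨hU.add hV, ?_, ?_⟩
    · rw [StateSpace.add_fst, StateSpace.add_snd, hU.memH1.valueAt_add hV.memH1 one_mem_Icc,
        hU1, hV1]
    · rw [StateSpace.add_fst, hU.memH1.valueAt_add hV.memH1 zero_mem_Icc, hU0, hV0, add_zero]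
  zero_mem' := ⟨memH2_zero, isContRep_zero.valueAt_eq one_mem_Icc,
    isContRep_zero.valueAt_eq zero_mem_Icc⟩
  smul_mem' := by
    rintro c U ⟨hU, hU1, hU0⟩
    refine ⟨hU.smul c, ?_, ?_⟩
    · rw [StateSpace.smul_fst, StateSpace.smul_snd, hU.memH1.valueAt_smul c one_mem_Icc, hU1]
    · rw [StateSpace.smul_fst, hU.memH1.valueAt_smul c zero_mem_Icc, hU0, mul_zero]

/-- The operator `𝒜` in `H` with domain `H₂`, given by
`𝒜 (u, u₁) = (u'', -(d/a) u'(1) + (b/a) u₁)`. -/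
def wentzellOperator (a b d : ℝ) [Fact (0 < a * d)] :
    StateSpace a d ℝ →ₗ.[ℝ] StateSpace a d ℝ where
  domain := spaceH2 a d
  toFun :=
    { toFun := fun U =>
        ⟨weakDeriv (weakDeriv U.1.fst),
          -(d / a) * valueAt (weakDeriv U.1.fst) 1 + b / a * U.1.snd⟩
      map_add' := by
        rintro ⟨U, hU, _⟩ ⟨V, hV, _⟩
        ext1
        · simp [hU.memH1.weakDeriv_add hV.memH1,
            hU.memH1_weakDeriv.weakDeriv_add hV.memH1_weakDeriv]
        · simp only [Submodule.coe_add, StateSpace.add_fst, StateSpace.add_snd,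
            hU.memH1.weakDeriv_add hV.memH1,
            hU.memH1_weakDeriv.valueAt_add hV.memH1_weakDeriv one_mem_Icc]
          ring
      map_smul' := by
        rintro c ⟨U, hU, _⟩
        ext1
        · simp [hU.memH1.weakDeriv_smul, hU.memH1_weakDeriv.weakDeriv_smul]
        · simp only [Submodule.coe_smul, StateSpace.smul_fst, StateSpace.smul_snd,
            hU.memH1.weakDeriv_smul, hU.memH1_weakDeriv.valueAt_smul c one_mem_Icc,
            RingHom.id_apply]
          ring }

/-! ### Semigroups -/

/-- `(T t)_{t ≥ 0}` is a `C₀`-semigroup on `X`. Only the values `T t` with `t ≥ 0` matter. -/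
structure IsC0Semigroup {X : Type*} [NormedAddCommGroup X] [NormedSpace ℝ X]
    (T : ℝ → X →L[ℝ] X) : Prop where
  map_zero : T 0 = 1
  map_add : ∀ s t : ℝ, 0 ≤ s → 0 ≤ t → T (s + t) = T s * T t
  continuousOn : ∀ x : X, ContinuousOn (fun t => T t x) (Ici 0)

/-- `A` is the generator of `(T t)_{t ≥ 0}`: `x ∈ D(A)` and `A x = y` if and only if
`(T t x - x) / t` tends to `y` as `t ↓ 0`. -/
def IsGenerator {X : Type*} [NormedAddCommGroup X] [NormedSpace ℝ X]
    (A : X →ₗ.[ℝ] X) (T : ℝ → X →L[ℝ] X) : Prop :=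
  ∀ x y : X, (x, y) ∈ A.graph ↔ Tendsto (fun t : ℝ => t⁻¹ • (T t x - x)) (𝓝[>] 0) (𝓝 y)

/-- The open sector of half-angle `δ` about the positive real axis. -/
def sector (δ : ℝ) : Set ℂ := {z | z ≠ 0 ∧ |z.arg| < δ}

/-- `(S z)_{z ∈ sector δ ∪ {0}}` is an analytic semigroup of angle `δ` on the complex space `X`. -/
structure IsAnalyticSemigroup {X : Type*} [NormedAddCommGroup X] [NormedSpace ℂ X]
    (δ : ℝ) (S : ℂ → X →L[ℂ] X) : Prop where
  map_zero : S 0 = 1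
  map_add : ∀ z ∈ sector δ, ∀ w ∈ sector δ, S (z + w) = S z * S w
  analytic : DifferentiableOn ℂ S (sector δ)
  tendsto : ∀ δ' : ℝ, 0 < δ' → δ' < δ → ∀ x : X,
    Tendsto (fun z => S z x) (𝓝[sector δ'] 0) (𝓝 x)

/-- The inclusion of `H = L²(0,1; ℝ) ⊕ ℝ` in its complexification `L²(0,1; ℂ) ⊕ ℂ`. -/
def complexify {a d : ℝ} (U : StateSpace a d ℝ) : StateSpace a d ℂ :=
  ⟨Complex.ofRealCLM.compLp U.fst, (U.snd : ℂ)⟩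

/-- The `C₀`-semigroup `(T t)_{t ≥ 0}` on the real space `H` is analytic of angle `δ`: its complex
linear extension to the complexification of `H` extends to an analytic semigroup of angle `δ`. -/
def IsAnalyticOfAngle {a d : ℝ} [Fact (0 < a * d)] (δ : ℝ)
    (T : ℝ → StateSpace a d ℝ →L[ℝ] StateSpace a d ℝ) : Prop :=
  ∃ S : ℂ → StateSpace a d ℂ →L[ℂ] StateSpace a d ℂ, IsAnalyticSemigroup δ S ∧
    ∀ t : ℝ, 0 ≤ t → ∀ U : StateSpace a d ℝ, S (t : ℂ) (complexify U) = complexify (T t U)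

end
end Wentzell

/-!
# The Wentzell operator generates a compact analytic semigroup of angle `π/2`

The operator is diagonalised. Let `J w = (u, u(1))` with `u(x) = ∫₀ˣ w`, a bounded operator from
`L²(0,1)` to `H`. Integration by parts gives `J† (f, f₁) (x) = ∫ₓ¹ f + (a/d) f₁`
(`isContRep_adjoint_J`), so that `(u, u₁) = J J† (f, f₁)` is the unique solution in `H₂` of
`-u'' = f`, `(d/a) u'(1) = f₁`: for `b = 0` the operator `𝒜` is `-(J J†)⁻¹`. The term with `b` is a
bounded symmetric perturbation, hence `𝒜 U = V` is equivalent to the integral equation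
`U = J J† (B U - V)` with `B (u, u₁) = (0, (b/a) u₁)` (`mem_graph_iff`); the regularity theory needed
here is the lemma of du Bois-Reymond (`IsWeakDeriv.exists_const`). The operator `J J†` is symmetric
and nonnegative by construction, and compact by the theorem of Arzelà–Ascoli
(`isCompactOperator_volterra`). For `ω > |b/a|` the Lax–Milgram theorem turns the integral equation
into `U = R (ω U - V)` with `R` compact, symmetric and nonnegative (`exists_perturbed_resolvent`),
that is, `R = (ω - 𝒜)⁻¹`.

The spectral theorem for `R` yields a Hilbert basis `eᵢ` of `H` and numbers `λᵢ ≤ ω` such that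
`(U, V)` lies in the graph of `𝒜` if and only if `⟪eᵢ, V⟫ = λᵢ ⟪eᵢ, U⟫` for all `i`
(`exists_hilbertBasis_of_resolvent`). The remaining assertions concern multiplication operators on
`ℓ²`. Self-adjointness is immediate. The semigroup multiplies the `i`-th coordinate by `exp (t λᵢ)`;
strong continuity and the form of the generator follow by dominated convergence
(`tendsto_of_repr`), and compactness because the operator for `t > 0` factors through `R`
(`isCompactOperator_expSemigroup`). The `eᵢ` also form a Hilbert basis of the complexification, in
which multiplication by `exp (z λᵢ)` defines the analytic extension; it is holomorphic in operator
norm on `0 < Re z` because of a Taylor estimate that is uniform in `λᵢ ≤ ω` (`norm_cexp_taylor_le`).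
-/

namespace Wentzell

open MeasureTheory Set Filter Topology

noncomputable section

/-! ### Operators that are diagonal in a Hilbert basis -/

section Diagonal

variable {ι : Type*} {𝕜 : Type*} [RCLike 𝕜] {E : Type*} [NormedAddCommGroup E]
  [InnerProductSpace 𝕜 E]

theorem repr_summable_sq (e : HilbertBasis ι 𝕜 E) (x : E) :
    Summable fun i => ‖e.repr x i‖ ^ 2 := by
  simpa using (lp.memℓp (e.repr x)).summable (by norm_num)

theorem norm_sq_eq_tsum_repr (e : HilbertBasis ι 𝕜 E) (x : E) :
    ‖x‖ ^ 2 = ∑' i, ‖e.repr x i‖ ^ 2 := by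
  have := lp.norm_rpow_eq_tsum (p := 2) (by norm_num) (e.repr x)
  simpa using this

theorem eq_of_repr (e : HilbertBasis ι 𝕜 E) {x y : E} (h : ∀ i, e.repr x i = e.repr y i) :
    x = y :=
  e.repr.injective (lp.ext (funext h))

theorem memℓp_bounded_mul {m : ι → 𝕜} {C : ℝ} (h : ∀ i, ‖m i‖ ≤ C) (f : lp (fun _ : ι => 𝕜) 2) :
    Memℓp (fun i => m i * f i) 2 := by
  refine memℓp_gen ?_
  have hs : Summable fun i => ‖f i‖ ^ 2 := by
    simpa using (lp.memℓp f).summable (by norm_num)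
  refine Summable.of_nonneg_of_le (fun i => by positivity) (fun i => ?_) (hs.mul_left (C ^ 2))
  have : ‖m i * f i‖ ≤ C * ‖f i‖ := by rw [norm_mul]; gcongr; exact h i
  simpa [mul_pow] using pow_le_pow_left₀ (norm_nonneg _) this 2

/-- The linear map that multiplies the `i`-th coordinate in the Hilbert basis `e` by `m i`. -/
def diagLin (e : HilbertBasis ι 𝕜 E) {m : ι → 𝕜} {C : ℝ} (h : ∀ i, ‖m i‖ ≤ C) : E →ₗ[𝕜] E where
  toFun x := e.repr.symm ⟨fun i => m i * e.repr x i, memℓp_bounded_mul h _⟩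
  map_add' x y := by
    rw [← map_add]
    congr 1
    ext i
    simp only [map_add, lp.coeFn_add, Pi.add_apply, mul_add]
  map_smul' c x := by
    rw [RingHom.id_apply, ← map_smul]
    congr 1
    ext i
    simp [mul_left_comm]

theorem repr_diagLin (e : HilbertBasis ι 𝕜 E) {m : ι → 𝕜} {C : ℝ} (h : ∀ i, ‖m i‖ ≤ C) (x : E)
    (i : ι) : e.repr (diagLin e h x) i = m i * e.repr x i := by
  simp [diagLin]

theorem norm_le_of_repr_le (e : HilbertBasis ι 𝕜 E) {x y : E} {C : ℝ} (hC : 0 ≤ C)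
    (h : ∀ i, ‖e.repr y i‖ ≤ C * ‖e.repr x i‖) : ‖y‖ ≤ C * ‖x‖ := by
  refine le_of_sq_le_sq ?_ (by positivity)
  rw [mul_pow, norm_sq_eq_tsum_repr e, norm_sq_eq_tsum_repr e, ← tsum_mul_left]
  refine (repr_summable_sq e y).tsum_le_tsum (fun i => ?_) ((repr_summable_sq e x).mul_left _)
  rw [← mul_pow]
  exact pow_le_pow_left₀ (norm_nonneg _) (h i) 2

open Classical in
/-- The bounded operator that multiplies the `i`-th coordinate in the Hilbert basis `e` by `m i`
(and `0` if the multipliers `m i` are not bounded). -/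
def diagOp (e : HilbertBasis ι 𝕜 E) (m : ι → 𝕜) : E →L[𝕜] E :=
  if h : ∃ C, ∀ i, ‖m i‖ ≤ C then
    (diagLin e h.choose_spec).mkContinuous |h.choose| fun x =>
      norm_le_of_repr_le e (abs_nonneg _) fun i => by
        rw [repr_diagLin, norm_mul]
        gcongr
        exact (h.choose_spec i).trans (le_abs_self _)
  else 0

theorem repr_diagOp (e : HilbertBasis ι 𝕜 E) {m : ι → 𝕜} {C : ℝ} (h : ∀ i, ‖m i‖ ≤ C) (x : E)
    (i : ι) : e.repr (diagOp e m x) i = m i * e.repr x i := by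
  have h' : ∃ C, ∀ i, ‖m i‖ ≤ C := ⟨C, h⟩
  rw [diagOp, dif_pos h', LinearMap.mkContinuous_apply, repr_diagLin]

/-- Convergence in a Hilbert space from convergence of the coordinates, given a summable bound. -/
theorem tendsto_of_repr (e : HilbertBasis ι 𝕜 E) {α : Type*} {l : Filter α} {f : α → E} {z : E}
    {bound : ι → ℝ} (hb : Summable bound)
    (hle : ∀ᶠ n in l, ∀ i, ‖e.repr (f n) i - e.repr z i‖ ^ 2 ≤ bound i)
    (hlim : ∀ i, Tendsto (fun n => e.repr (f n) i) l (𝓝 (e.repr z i))) :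
    Tendsto f l (𝓝 z) := by
  rw [tendsto_iff_norm_sub_tendsto_zero]
  have key : Tendsto (fun n => ∑' i, ‖e.repr (f n) i - e.repr z i‖ ^ 2) l (𝓝 (∑' _ : ι, (0 : ℝ))) := by
    refine tendsto_tsum_of_dominated_convergence hb (fun i => ?_) ?_
    · have := ((hlim i).sub_const (e.repr z i)).norm.pow 2
      simpa using this
    · filter_upwards [hle] with n hn i
      simpa using hn i
  have h2 : (fun n => ‖f n - z‖) = fun n => √(∑' i, ‖e.repr (f n) i - e.repr z i‖ ^ 2) := by
    funext n
    rw [← Real.sqrt_sq (norm_nonneg (f n - z)), norm_sq_eq_tsum_repr e]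
    simp
  rw [h2]
  have := (Real.continuous_sqrt.tendsto _).comp key
  rwa [tsum_zero, Real.sqrt_zero] at this

/-- Bounded families of multipliers that converge pointwise give strongly convergent operators. -/
theorem tendsto_diagOp (e : HilbertBasis ι 𝕜 E) {α : Type*} {l : Filter α} {m : α → ι → 𝕜}
    {m₀ : ι → 𝕜} {C : ℝ} (h₀ : ∀ i, ‖m₀ i‖ ≤ C) (hle : ∀ᶠ n in l, ∀ i, ‖m n i‖ ≤ C)
    (hlim : ∀ i, Tendsto (fun n => m n i) l (𝓝 (m₀ i))) (x : E) :
    Tendsto (fun n => diagOp e (m n) x) l (𝓝 (diagOp e m₀ x)) := by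
  refine tendsto_of_repr e ((repr_summable_sq e x).mul_left ((2 * C) ^ 2)) ?_ fun i => ?_
  · filter_upwards [hle] with n hn i
    rw [repr_diagOp e hn, repr_diagOp e h₀, ← sub_mul, norm_mul, mul_pow]
    gcongr
    calc ‖m n i - m₀ i‖ ≤ ‖m n i‖ + ‖m₀ i‖ := norm_sub_le _ _
      _ ≤ 2 * C := by linarith [hn i, h₀ i]
  · rw [repr_diagOp e h₀]
    refine ((hlim i).mul_const _).congr' ?_
    filter_upwards [hle] with n hn
    rw [repr_diagOp e hn]

theorem diagOp_one (e : HilbertBasis ι 𝕜 E) : diagOp e (fun _ => 1) = 1 := by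
  ext x
  refine eq_of_repr e fun i => ?_
  rw [repr_diagOp e (C := 1) (by simp)]
  simp

theorem diagOp_mul (e : HilbertBasis ι 𝕜 E) {m n : ι → 𝕜} {C D : ℝ} (hm : ∀ i, ‖m i‖ ≤ C)
    (hn : ∀ i, ‖n i‖ ≤ D) : diagOp e (fun i => m i * n i) = diagOp e m * diagOp e n := by
  ext x
  refine eq_of_repr e fun i => ?_
  rw [repr_diagOp e (C := C * D), mul_apply_eq_comp, repr_diagOp e hm,
    repr_diagOp e hn, mul_assoc]
  intro j
  rw [norm_mul]
  exact mul_le_mul (hm j) (hn j) (norm_nonneg _) ((norm_nonneg _).trans (hm j))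

theorem norm_le_of_repr_clm (e : HilbertBasis ι 𝕜 E) {L : E →L[𝕜] E} {C : ℝ} (hC : 0 ≤ C)
    (h : ∀ x i, ‖e.repr (L x) i‖ ≤ C * ‖e.repr x i‖) : ‖L‖ ≤ C :=
  L.opNorm_le_bound hC fun x => norm_le_of_repr_le e hC (h x)

end Diagonal

/-! ### Diagonal semigroups on real Hilbert spaces -/

section RealSemigroup

variable {ι : Type*} {E : Type*} [NormedAddCommGroup E] [InnerProductSpace ℝ E]

/-- The semigroup on a real Hilbert space that acts in the Hilbert basis `e` as multiplication of
the `i`-th coordinate by `exp (t λᵢ)`. If the `λᵢ` are bounded above only, this is meaningful for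
`t ≥ 0`; where the multipliers are unbounded the value is `0`. -/
def expSemigroup (e : HilbertBasis ι ℝ E) (lam : ι → ℝ) (t : ℝ) : E →L[ℝ] E :=
  diagOp e fun i => Real.exp (t * lam i)

theorem norm_exp_mul_le {lam ω t s : ℝ} (hl : lam ≤ ω) (ht : 0 ≤ t) (hts : t ≤ s) :
    ‖Real.exp (t * lam)‖ ≤ Real.exp (s * |ω|) := by
  rw [Real.norm_eq_abs, Real.abs_exp, Real.exp_le_exp]
  calc t * lam ≤ t * |ω| := by gcongr; exact hl.trans (le_abs_self _)
    _ ≤ s * |ω| := by gcongr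

/-- Domination of the difference quotients of `t ↦ exp (t λ)`, with a constant uniform in `λ ≤ ω`. -/
theorem abs_inv_mul_exp_sub_one_le {lam ω t : ℝ} (hl : lam ≤ ω) (ht : 0 < t) (ht1 : t ≤ 1) :
    |t⁻¹ * (Real.exp (t * lam) - 1)| ≤ Real.exp |ω| * |lam| := by
  have h1 : |Real.exp (t * lam) - 1| ≤ Real.exp |ω| * |t * lam| := by
    have hone : 1 ≤ Real.exp |ω| := Real.one_le_exp (abs_nonneg _)
    rcases le_total (t * lam) 0 with h | h
    · rw [abs_of_nonpos (by simpa using h), abs_of_nonpos h]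
      nlinarith [Real.add_one_le_exp (t * lam)]
    · rw [abs_of_nonneg (by simpa using h), abs_of_nonneg h]
      have h2 : Real.exp (t * lam) ≤ Real.exp |ω| := by
        simpa using (le_abs_self _).trans (norm_exp_mul_le hl ht.le ht1)
      have h3 := Real.add_one_le_exp (-(t * lam))
      have h4 : Real.exp (t * lam) * Real.exp (-(t * lam)) = 1 := by
        rw [← Real.exp_add, add_neg_cancel, Real.exp_zero]
      nlinarith [Real.exp_pos (t * lam)]
  rw [abs_mul, abs_of_pos (inv_pos.2 ht)]
  rw [abs_mul, abs_of_pos ht] at h1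
  rw [inv_mul_le_iff₀ ht]
  linarith

variable (e : HilbertBasis ι ℝ E) {lam : ι → ℝ} {ω : ℝ} (hl : ∀ i, lam i ≤ ω)
include hl

theorem repr_expSemigroup {t : ℝ} (ht : 0 ≤ t) (x : E) (i : ι) :
    e.repr (expSemigroup e lam t x) i = Real.exp (t * lam i) * e.repr x i :=
  repr_diagOp e (fun j => norm_exp_mul_le (hl j) ht le_rfl) x i

theorem isC0Semigroup_expSemigroup : IsC0Semigroup (expSemigroup e lam) where
  map_zero := by simp [expSemigroup, diagOp_one]
  map_add s t hs ht := by
    simp only [expSemigroup, add_mul, Real.exp_add]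
    exact diagOp_mul e (fun j => norm_exp_mul_le (hl j) hs le_rfl)
      (fun j => norm_exp_mul_le (hl j) ht le_rfl)
  continuousOn x t ht := by
    refine tendsto_diagOp e (C := Real.exp ((t + 1) * |ω|))
      (fun i => norm_exp_mul_le (hl i) ht (by linarith)) ?_ (fun i => ?_) x
    · filter_upwards [self_mem_nhdsWithin,
        mem_nhdsWithin_of_mem_nhds (Iio_mem_nhds (lt_add_one t))] with s hs hs' i
      exact norm_exp_mul_le (hl i) hs hs'.le
    · exact (by fun_prop : Continuous fun s : ℝ => Real.exp (s * lam i)).continuousWithinAt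

/-- If `A` is the operator with eigenvectors `e i` and eigenvalues `λᵢ` on its maximal domain, then
it generates the semigroup `exp (t λᵢ)`: the difference quotients converge coordinatewise, and
are dominated by the coordinates of `A x`. -/
theorem isGenerator_expSemigroup (A : E →ₗ.[ℝ] E)
    (hA : ∀ x y, (x, y) ∈ A.graph ↔ ∀ i, e.repr y i = lam i * e.repr x i) :
    IsGenerator A (expSemigroup e lam) := by
  intro x y
  have hrep {t : ℝ} (ht : 0 < t) (i : ι) : e.repr (t⁻¹ • (expSemigroup e lam t x - x)) i =
      t⁻¹ * (Real.exp (t * lam i) - 1) * e.repr x i := by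
    simp only [map_smul, map_sub, lp.coeFn_smul, lp.coeFn_sub, Pi.smul_apply, Pi.sub_apply,
      repr_expSemigroup e hl ht.le, smul_eq_mul]
    ring
  have hlim (i : ι) : Tendsto (fun t => e.repr (t⁻¹ • (expSemigroup e lam t x - x)) i) (𝓝[>] 0)
      (𝓝 (lam i * e.repr x i)) := by
    have h1 : HasDerivAt (fun t : ℝ => Real.exp (t * lam i)) (lam i) 0 := by
      simpa using ((hasDerivAt_id (0 : ℝ)).mul_const (lam i)).exp
    have h2 := (h1.tendsto_slope_zero_right).mul_const (e.repr x i)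
    refine h2.congr' ?_
    filter_upwards [self_mem_nhdsWithin] with t ht
    rw [hrep ht]
    simp
  rw [hA]
  constructor
  · intro h
    refine tendsto_of_repr e ((repr_summable_sq e y).mul_left ((Real.exp |ω| + 1) ^ 2)) ?_
      fun i => by rw [h i]; exact hlim i
    filter_upwards [self_mem_nhdsWithin,
      mem_nhdsWithin_of_mem_nhds (Iio_mem_nhds one_pos)] with t ht ht1 i
    rw [← mul_pow]
    refine pow_le_pow_left₀ (norm_nonneg _) ?_ 2
    rw [hrep ht, h i, ← sub_mul, norm_mul, norm_mul, ← mul_assoc]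
    refine mul_le_mul_of_nonneg_right ?_ (norm_nonneg _)
    refine (norm_sub_le _ _).trans ?_
    have := abs_inv_mul_exp_sub_one_le (hl i) ht ht1.le
    simp only [Real.norm_eq_abs] at this ⊢
    linarith
  · intro h i
    have hc : Continuous fun z : E => e.repr z i := by
      simp only [e.repr_apply_apply]
      fun_prop
    exact tendsto_nhds_unique ((hc.tendsto y).comp h) (hlim i)

end RealSemigroup

/-! ### Diagonal semigroups on complex Hilbert spaces -/

section ComplexSemigroup

variable {ι : Type*} {X : Type*} [NormedAddCommGroup X] [InnerProductSpace ℂ X]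

/-- The semigroup on a complex Hilbert space that acts in the Hilbert basis `e` as multiplication
of the `i`-th coordinate by `exp (z λᵢ)`. If the `λᵢ` are bounded above only, this is meaningful for
`0 ≤ Re z`. -/
def cexpSemigroup (e : HilbertBasis ι ℂ X) (lam : ι → ℝ) (z : ℂ) : X →L[ℂ] X :=
  diagOp e fun i => Complex.exp (z * lam i)

theorem norm_cexp_mul_le {lam ω s : ℝ} {z : ℂ} (hl : lam ≤ ω) (hz : 0 ≤ z.re) (hs : z.re ≤ s) :
    ‖Complex.exp (z * lam)‖ ≤ Real.exp (s * |ω|) := by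
  rw [Complex.norm_exp, Complex.re_mul_ofReal]
  simpa using norm_exp_mul_le hl hz hs

theorem mem_sector_iff {z : ℂ} : z ∈ sector (Real.pi / 2) ↔ 0 < z.re := by
  simp only [sector, mem_ofPred_eq, Complex.abs_arg_lt_pi_div_two_iff]
  constructor
  · rintro ⟨h, h' | h'⟩
    · exact h'
    · exact absurd h' h
  · intro h
    exact ⟨by rintro rfl; simp at h, Or.inl h⟩

/-- If `λ ≤ ω`, then `exp (r λ)` absorbs `exp (r |λ|)`: either `λ` is negative and the two cancel, or
`|λ| ≤ |ω|`. -/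
theorem exp_mul_abs_le {lam ω r : ℝ} (hl : lam ≤ ω) (hr : 0 ≤ r) :
    Real.exp (r * lam) * Real.exp (r * |lam|) ≤ Real.exp (2 * r * |ω|) := by
  rw [← Real.exp_add, Real.exp_le_exp]
  have : lam + |lam| ≤ 2 * |ω| := by
    rcases le_total 0 lam with h | h
    · rw [abs_of_nonneg h]; linarith [le_abs_self ω]
    · rw [abs_of_nonpos h]; linarith [abs_nonneg ω]
  nlinarith

theorem norm_mul_cexp_le {lam ω : ℝ} {z : ℂ} (hl : lam ≤ ω) (hz : 0 < z.re) :
    ‖(lam : ℂ) * Complex.exp (z * lam)‖ ≤ z.re⁻¹ * Real.exp (2 * z.re * |ω|) := by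
  rw [norm_mul, Complex.norm_exp, Complex.re_mul_ofReal, Complex.norm_real, Real.norm_eq_abs]
  have h1 : |lam| ≤ z.re⁻¹ * Real.exp (z.re * |lam|) := by
    rw [le_inv_mul_iff₀ hz]
    linarith [Real.add_one_le_exp (z.re * |lam|)]
  calc |lam| * Real.exp (z.re * lam)
      ≤ z.re⁻¹ * Real.exp (z.re * |lam|) * Real.exp (z.re * lam) := by gcongr
    _ = z.re⁻¹ * (Real.exp (z.re * lam) * Real.exp (z.re * |lam|)) := by ring
    _ ≤ _ := by gcongr; exact exp_mul_abs_le hl hz.le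

/-- Second order Taylor estimate for `z ↦ exp (z λ)`, uniform in `λ ≤ ω`. -/
theorem norm_cexp_taylor_le {lam ω : ℝ} {z h : ℂ} (hl : lam ≤ ω) (hz : 0 < z.re)
    (hh : ‖h‖ ≤ z.re / 2) :
    ‖Complex.exp ((z + h) * lam) - Complex.exp (z * lam) -
        h * (lam * Complex.exp (z * lam))‖ ≤
      8 / z.re ^ 2 * Real.exp (2 * z.re * |ω|) * ‖h‖ ^ 2 := by
  set r := z.re with hr
  have e1 : Complex.exp ((z + h) * lam) - Complex.exp (z * lam) -
      h * (lam * Complex.exp (z * lam)) =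
      Complex.exp (z * lam) * (Complex.exp (h * lam) - ∑ m ∈ Finset.range 2,
        (h * lam) ^ m / m.factorial) := by
    rw [add_mul, Complex.exp_add]
    simp [Finset.sum_range_succ]
    ring
  have h2 := Complex.norm_exp_sub_sum_le_norm_mul_exp (h * lam) 2
  have h3 : ‖h * lam‖ ≤ r / 2 * |lam| := by
    rw [norm_mul, Complex.norm_real, Real.norm_eq_abs]; gcongr
  -- `λ²` costs a factor `exp (r |λ| / 2)`, and so does the remainder in `h2`: together they make up
  -- the factor `exp (r |λ|)` that `exp_mul_abs_le` absorbs
  have h4 : |lam| ^ 2 ≤ 8 / r ^ 2 * Real.exp (r / 2 * |lam|) := by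
    have := Real.quadratic_le_exp_of_nonneg (x := r / 2 * |lam|) (by positivity)
    rw [div_mul_eq_mul_div, le_div_iff₀ (by positivity)]
    nlinarith [mul_nonneg hz.le (abs_nonneg lam)]
  rw [e1, norm_mul, Complex.norm_exp, Complex.re_mul_ofReal, ← hr]
  calc Real.exp (r * lam) * _
      ≤ Real.exp (r * lam) * (‖h * lam‖ ^ 2 * Real.exp (r / 2 * |lam|)) := by
        gcongr
        exact h2.trans (by gcongr)
    _ = Real.exp (r * lam) * (|lam| ^ 2 * Real.exp (r / 2 * |lam|)) * ‖h‖ ^ 2 := by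
        rw [norm_mul, Complex.norm_real, Real.norm_eq_abs]; ring
    _ ≤ Real.exp (r * lam) * (8 / r ^ 2 * Real.exp (r / 2 * |lam|) * Real.exp (r / 2 * |lam|))
          * ‖h‖ ^ 2 := by gcongr
    _ = 8 / r ^ 2 * (Real.exp (r * lam) * Real.exp (r * |lam|)) * ‖h‖ ^ 2 := by
        have : Real.exp (r * |lam|) = Real.exp (r / 2 * |lam|) * Real.exp (r / 2 * |lam|) := by
          rw [← Real.exp_add]; ring_nf
        rw [this]; ring
    _ ≤ _ := by gcongr; exact exp_mul_abs_le hl hz.le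

variable (e : HilbertBasis ι ℂ X) {lam : ι → ℝ} {ω : ℝ} (hl : ∀ i, lam i ≤ ω)
include hl

theorem repr_cexpSemigroup {z : ℂ} (hz : 0 ≤ z.re) (x : X) (i : ι) :
    e.repr (cexpSemigroup e lam z x) i = Complex.exp (z * lam i) * e.repr x i :=
  repr_diagOp e (fun j => norm_cexp_mul_le (hl j) hz le_rfl) x i

theorem hasDerivAt_cexpSemigroup {z : ℂ} (hz : 0 < z.re) :
    HasDerivAt (cexpSemigroup e lam) (diagOp e fun i => lam i * Complex.exp (z * lam i)) z := by
  rw [hasDerivAt_iff_isLittleO_nhds_zero]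
  refine Asymptotics.IsBigO.trans_isLittleO (g := fun h : ℂ => ‖h‖ ^ 2) ?_ ?_
  · refine Asymptotics.IsBigO.of_bound (8 / z.re ^ 2 * Real.exp (2 * z.re * |ω|)) ?_
    filter_upwards [Metric.closedBall_mem_nhds (0 : ℂ) (half_pos hz)] with h hh
    rw [mem_closedBall_zero_iff] at hh
    have hre : 0 ≤ (z + h).re := by
      have := (Complex.abs_re_le_norm h).trans hh
      rw [Complex.add_re]
      linarith [neg_abs_le h.re]
    refine norm_le_of_repr_clm e (by positivity) fun x i => ?_
    have : e.repr ((cexpSemigroup e lam (z + h) - cexpSemigroup e lam z -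
          h • diagOp e fun i => lam i * Complex.exp (z * lam i)) x) i =
        (Complex.exp ((z + h) * lam i) - Complex.exp (z * lam i) -
          h * (lam i * Complex.exp (z * lam i))) * e.repr x i := by
      simp only [sub_apply, smul_apply, map_sub, map_smul,
        lp.coeFn_sub, lp.coeFn_smul, Pi.sub_apply, Pi.smul_apply, smul_eq_mul,
        repr_cexpSemigroup e hl hre, repr_cexpSemigroup e hl hz.le,
        repr_diagOp e (fun j => norm_mul_cexp_le (hl j) hz)]
      ring
    rw [this, norm_mul, norm_pow, norm_norm]
    gcongr
    exact norm_cexp_taylor_le (hl i) hz hh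
  · have := (Asymptotics.isLittleO_norm_pow_id (E' := ℂ) one_lt_two)
    simpa using this

theorem isAnalyticSemigroup_cexpSemigroup :
    IsAnalyticSemigroup (Real.pi / 2) (cexpSemigroup e lam) where
  map_zero := by simp [cexpSemigroup, diagOp_one]
  map_add z hz w hw := by
    rw [mem_sector_iff] at hz hw
    simp only [cexpSemigroup, add_mul, Complex.exp_add]
    exact diagOp_mul e (fun j => norm_cexp_mul_le (hl j) hz.le le_rfl)
      (fun j => norm_cexp_mul_le (hl j) hw.le le_rfl)
  analytic z hz :=
    (hasDerivAt_cexpSemigroup e hl (mem_sector_iff.1 hz)).differentiableAt.differentiableWithinAt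
  tendsto δ' _ hδ' x := by
    have h1 : diagOp e (fun _ => 1) x = x := by rw [diagOp_one]; rfl
    nth_rewrite 2 [← h1]
    refine tendsto_diagOp e (C := Real.exp (1 * |ω|)) (by simp) ?_ (fun i => ?_) x
    · have hU : {z : ℂ | z.re < 1} ∈ 𝓝 (0 : ℂ) :=
        (isOpen_lt Complex.continuous_re continuous_const).mem_nhds (by simp)
      filter_upwards [self_mem_nhdsWithin, mem_nhdsWithin_of_mem_nhds hU] with z hz hz1 i
      have : 0 < z.re := mem_sector_iff.1 ⟨hz.1, hz.2.trans hδ'⟩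
      exact norm_cexp_mul_le (hl i) this.le (le_of_lt hz1)
    · have : Continuous fun z : ℂ => Complex.exp (z * lam i) := by fun_prop
      simpa using (this.tendsto 0).mono_left nhdsWithin_le_nhds

end ComplexSemigroup

/-! ### Operators with compact resolvent -/

section Resolvent

universe u v

variable {E : Type u} [NormedAddCommGroup E] [InnerProductSpace ℝ E] [CompleteSpace E]

omit [CompleteSpace E] in
theorem orthogonal_span_range_sigma_eq_bot {κ : Type*} {V : κ → Submodule ℝ E}
    (hbot : (⨆ k, V k)ᗮ = ⊥) {w : κ → Type*} (b : ∀ k, HilbertBasis (w k) ℝ (V k)) :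
    (Submodule.span ℝ (range fun p : Σ k, w k => ((b p.1 p.2 : V p.1) : E)))ᗮ = ⊥ := by
  rw [eq_bot_iff, ← hbot]
  intro x hx
  rw [Submodule.mem_orthogonal] at hx
  rw [← Submodule.iInf_orthogonal, Submodule.mem_iInf]
  intro k
  rw [Submodule.mem_orthogonal]
  intro v hv
  have h1 : HasSum (fun j => inner ℝ x (((b k).repr ⟨v, hv⟩ j • b k j : V k) : E))
      (inner ℝ x v) :=
    ((b k).hasSum_repr ⟨v, hv⟩).mapL (innerSL ℝ x ∘L (V k).subtypeL)
  have h2 (j : w k) : inner ℝ x (((b k).repr ⟨v, hv⟩ j • b k j : V k) : E) = 0 := by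
    have := hx _ (Submodule.subset_span ⟨⟨k, j⟩, rfl⟩)
    rw [real_inner_comm] at this
    rw [Submodule.coe_smul, inner_smul_right, this, mul_zero]
  simp only [h2] at h1
  rw [real_inner_comm]
  exact h1.unique hasSum_zero

/-- Hilbert bases of the members of an orthogonal family of closed subspaces that spans a dense
subspace combine to a Hilbert basis of the whole space. -/
theorem exists_hilbertBasis_of_orthogonalFamily {κ : Type v} {V : κ → Submodule ℝ E}
    (hcl : ∀ k, IsClosed (V k : Set E))
    (hV : OrthogonalFamily ℝ (fun k => V k) fun k => (V k).subtypeₗᵢ)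
    (hbot : (⨆ k, V k)ᗮ = ⊥) :
    ∃ (ι : Type (max u v)) (e : HilbertBasis ι ℝ E) (k : ι → κ), ∀ i, e i ∈ V (k i) := by
  have (k : κ) : CompleteSpace (V k) := (hcl k).completeSpace_coe
  choose w b _ using fun k => exists_hilbertBasis ℝ (V k)
  have horth : Orthonormal ℝ fun p : Σ k, w k => ((b p.1 p.2 : V p.1) : E) :=
    hV.orthonormal_sigma_orthonormal fun k => (b k).orthonormal
  refine ⟨_, HilbertBasis.mkOfOrthogonalEqBot horth (orthogonal_span_range_sigma_eq_bot hbot b),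
    fun p => p.1, fun p => ?_⟩
  rw [HilbertBasis.coe_mkOfOrthogonalEqBot]
  exact (b p.1 p.2).2

/-- A compact symmetric operator on a Hilbert space has a Hilbert basis of eigenvectors. -/
theorem exists_hilbertBasis_eigenvectors {R : E →L[ℝ] E} (hc : IsCompactOperator R)
    (hs : R.IsSymmetric) :
    ∃ (ι : Type u) (e : HilbertBasis ι ℝ E) (μ : ι → ℝ), ∀ i, R (e i) = μ i • e i := by
  have hcl (μ : ℝ) : IsClosed (Module.End.eigenspace (R : E →ₗ[ℝ] E) μ : Set E) := by
    have : (Module.End.eigenspace (R : E →ₗ[ℝ] E) μ : Set E) = {x | R x = μ • x} :=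
      Set.ext fun x => Module.End.mem_eigenspace_iff
    rw [this]
    exact isClosed_eq R.continuous (continuous_const_smul μ)
  obtain ⟨ι, e, μ, h⟩ := exists_hilbertBasis_of_orthogonalFamily hcl
    hs.orthogonalFamily_eigenspaces (R.orthogonalComplement_iSup_eigenspaces_eq_bot hc hs)
  exact ⟨ι, e, μ, fun i => Module.End.mem_eigenspace_iff.1 (h i)⟩

/-- An operator `A` whose resolvent `R = (ω - A)⁻¹` is compact, symmetric and nonnegative is
diagonal, on its maximal domain, in a Hilbert basis of eigenvectors, with eigenvalues at most `ω`. -/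
theorem exists_hilbertBasis_of_resolvent {A : E →ₗ.[ℝ] E} {R : E →L[ℝ] E} {ω : ℝ}
    (hc : IsCompactOperator R) (hs : R.IsSymmetric) (hn : ∀ x, 0 ≤ inner ℝ x (R x))
    (hA : ∀ x y, (x, y) ∈ A.graph ↔ x = R (ω • x - y)) :
    ∃ (ι : Type u) (e : HilbertBasis ι ℝ E) (lam : ι → ℝ), (∀ i, lam i ≤ ω) ∧
      (∀ x y, (x, y) ∈ A.graph ↔ ∀ i, e.repr y i = lam i * e.repr x i) ∧
      ∀ z i, (ω - lam i) * e.repr (R z) i = e.repr z i := by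
  obtain ⟨ι, e, μ, he⟩ := exists_hilbertBasis_eigenvectors hc hs
  have hone (i : ι) : ‖e i‖ = 1 := e.orthonormal.1 i
  have hR (z : E) (i : ι) : e.repr (R z) i = μ i * e.repr z i := by
    rw [e.repr_apply_apply, e.repr_apply_apply]
    have := hs (e i) z
    simp only [ContinuousLinearMap.coe_coe] at this
    rw [← this, he, real_inner_smul_left]
  have hpos (i : ι) : 0 < μ i := by
    have h0 : 0 ≤ μ i := by
      have := hn (e i)
      rwa [he, real_inner_smul_right, real_inner_self_eq_norm_sq, hone, one_pow, mul_one] at this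
    refine h0.lt_of_ne' fun h => ?_
    -- an eigenvector with eigenvalue `0` would put `(0, -e i)` into the graph of `A`
    have h1 : ((0 : E), -e i) ∈ A.graph := by
      rw [hA, smul_zero, zero_sub, neg_neg, he, h, zero_smul]
    have h2 : -e i = 0 := A.graph_fst_eq_zero_snd h1 rfl
    have := hone i
    rw [neg_eq_zero.1 h2, norm_zero] at this
    exact zero_ne_one this
  refine ⟨ι, e, fun i => ω - (μ i)⁻¹, fun i => by simpa using (hpos i).le, fun x y => ?_,
    fun z i => ?_⟩
  · rw [hA]
    have h1 : x = R (ω • x - y) ↔ ∀ i, e.repr x i = e.repr (R (ω • x - y)) i :=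
      ⟨fun h i => by rw [← h], eq_of_repr e⟩
    rw [h1]
    refine forall_congr' fun i => ?_
    rw [hR]
    simp only [map_sub, map_smul, lp.coeFn_sub, lp.coeFn_smul, Pi.sub_apply, Pi.smul_apply,
      smul_eq_mul]
    have := (hpos i).ne'
    constructor
    · intro h
      field_simp
      linarith
    · intro h
      rw [h]
      field_simp
      ring
  · rw [hR, sub_sub_cancel, inv_mul_cancel_left₀ (hpos i).ne']

section Diagonal

variable {ι : Type*} (e : HilbertBasis ι ℝ E) {lam : ι → ℝ} {A : E →ₗ.[ℝ] E}
  (hA : ∀ x y, (x, y) ∈ A.graph ↔ ∀ i, e.repr y i = lam i * e.repr x i)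
include hA

omit [CompleteSpace E] in
theorem basis_mem_graph (i : ι) : (e i, lam i • e i) ∈ A.graph := by
  classical
  rw [hA]
  intro j
  rw [map_smul, e.repr_self, lp.coeFn_smul, Pi.smul_apply, lp.coeFn_single, smul_eq_mul]
  rcases eq_or_ne j i with rfl | h
  · rfl
  · rw [Pi.single_eq_of_ne h, mul_zero, mul_zero]

omit [CompleteSpace E] in
theorem dense_domain_of_diagonal : Dense (A.domain : Set E) := by
  rw [Submodule.dense_iff_topologicalClosure_eq_top, eq_top_iff, ← e.dense_span]
  refine Submodule.topologicalClosure_mono (Submodule.span_le.2 ?_)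
  rintro _ ⟨i, rfl⟩
  exact A.mem_domain_of_mem_graph (basis_mem_graph e hA i)

/-- An operator that is diagonal with real eigenvalues, on its maximal domain, is self-adjoint. -/
theorem isSelfAdjoint_of_diagonal : IsSelfAdjoint A := by
  rw [LinearPMap.isSelfAdjoint_def]
  refine LinearPMap.eq_of_eq_graph ?_
  rw [LinearPMap.adjoint_graph_eq_graph_adjoint (dense_domain_of_diagonal e hA)]
  ext ⟨x, y⟩
  rw [Submodule.mem_adjoint_iff]
  constructor
  · intro h
    rw [hA]
    intro i
    have := h _ _ (basis_mem_graph e hA i)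
    rw [real_inner_smul_left] at this
    rw [e.repr_apply_apply, e.repr_apply_apply]
    linarith
  · intro h u v huv
    rw [hA] at h huv
    rw [sub_eq_zero, ← e.repr.inner_map_map v, ← e.repr.inner_map_map u, lp.inner_eq_tsum,
      lp.inner_eq_tsum]
    refine tsum_congr fun i => ?_
    simp only [h i, huv i, RCLike.inner_apply, conj_trivial]
    ring

end Diagonal

omit [CompleteSpace E] in
/-- Smoothing: for `t > 0` the semigroup factors through the compact resolvent. -/
theorem isCompactOperator_expSemigroup {ι : Type*} (e : HilbertBasis ι ℝ E) {lam : ι → ℝ} {ω : ℝ}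
    {R : E →L[ℝ] E} (hc : IsCompactOperator R) (hl : ∀ i, lam i ≤ ω)
    (hR : ∀ z i, (ω - lam i) * e.repr (R z) i = e.repr z i) {t : ℝ} (ht : 0 < t) :
    IsCompactOperator (expSemigroup e lam t) := by
  have hb (i : ι) : ‖(ω - lam i) * Real.exp (t * lam i)‖ ≤ t⁻¹ * Real.exp (t * ω) := by
    have h0 : 0 ≤ ω - lam i := sub_nonneg.2 (hl i)
    rw [norm_mul, Real.norm_of_nonneg h0, Real.norm_of_nonneg (Real.exp_pos _).le,
      le_inv_mul_iff₀ ht]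
    have h1 : Real.exp (t * ω) = Real.exp (t * (ω - lam i)) * Real.exp (t * lam i) := by
      rw [← Real.exp_add]; ring_nf
    rw [h1, ← mul_assoc]
    gcongr
    linarith [Real.add_one_le_exp (t * (ω - lam i))]
  have : ⇑(expSemigroup e lam t) =
      R ∘ diagOp e fun i => (ω - lam i) * Real.exp (t * lam i) := by
    funext x
    refine eq_of_repr e fun i => ?_
    have h1 := hR (diagOp e (fun i => (ω - lam i) * Real.exp (t * lam i)) x) i
    have h2 := hR (e i) i
    have h3 : ω - lam i ≠ 0 := by
      classical
      rintro h
      rw [h, zero_mul, e.repr_self, lp.coeFn_single, Pi.single_eq_same] at h2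
      exact zero_ne_one h2
    rw [repr_diagOp e hb, mul_assoc] at h1
    rw [repr_expSemigroup e hl ht.le]
    exact (mul_left_cancel₀ h3 h1).symm
  rw [this]
  exact hc.comp_clm _

/-- If `-R₀⁻¹` is perturbed by a bounded symmetric operator `-C` with `C` coercive, then the inverse
`R = (R₀⁻¹ + C)⁻¹` exists and inherits compactness, symmetry and nonnegativity from `R₀`. The
equation `u = R₀ (z - C u)` is solved by the Lax–Milgram theorem for the form
`⟪C u, v⟫ + ⟪R₀ C u, C v⟫`. -/
theorem exists_perturbed_resolvent {R₀ C : E →L[ℝ] E} (hc : IsCompactOperator R₀)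
    (hs : R₀.IsSymmetric) (hn : ∀ x, 0 ≤ inner ℝ x (R₀ x)) (hC : C.IsSymmetric) {c : ℝ}
    (hc0 : 0 < c) (hcoer : ∀ u, c * ‖u‖ ^ 2 ≤ inner ℝ (C u) u) :
    ∃ R : E →L[ℝ] E, IsCompactOperator R ∧ R.IsSymmetric ∧ (∀ x, 0 ≤ inner ℝ x (R x)) ∧
      ∀ x z, x = R z ↔ x = R₀ (z - C x) := by
  have hs' (x y : E) : inner ℝ (R₀ x) y = inner ℝ x (R₀ y) := hs x y
  have hC' (x y : E) : inner ℝ (C x) y = inner ℝ x (C y) := hC x y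
  set M : E →L[ℝ] E := C + C ∘L R₀ ∘L C with hM
  have hMc : IsCoercive ((innerSL ℝ : E →L[ℝ] E →L[ℝ] ℝ) ∘L M) := by
    refine ⟨c, hc0, fun u => ?_⟩
    have h1 := hcoer u
    have h2 := hn (C u)
    rw [← hs', ← hC'] at h2
    show c * ‖u‖ * ‖u‖ ≤ inner ℝ (C u + C (R₀ (C u))) u
    rw [inner_add_left]
    nlinarith
  set L := hMc.continuousLinearEquivOfBilin with hL
  have hLM (u : E) : L u = M u := by
    refine ext_inner_right ℝ fun v => ?_
    rw [hL, hMc.continuousLinearEquivOfBilin_apply]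
    rfl
  have hCinj {u : E} (hu : C u = 0) : u = 0 := by
    have := hcoer u
    rw [hu, inner_zero_left] at this
    have h2 : ‖u‖ ^ 2 = 0 := by nlinarith [sq_nonneg ‖u‖]
    simpa using h2
  have hiff (x z : E) : x = (L.symm : E →L[ℝ] E) (C (R₀ z)) ↔ x = R₀ (z - C x) := by
    have h1 : x = (L.symm : E →L[ℝ] E) (C (R₀ z)) ↔ M x = C (R₀ z) := by
      rw [← hLM]
      exact L.toEquiv.eq_symm_apply
    have h2 : M x - C (R₀ z) = C (x - R₀ (z - C x)) := by
      simp only [hM, add_apply, ContinuousLinearMap.comp_apply, map_sub]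
      abel
    rw [h1, ← sub_eq_zero, h2, ← sub_eq_zero (a := x)]
    exact ⟨hCinj, fun h => by rw [h, map_zero]⟩
  set R : E →L[ℝ] E := (L.symm : E →L[ℝ] E) ∘L C ∘L R₀ with hR
  have hRe (z : E) : R z = R₀ (z - C (R z)) := (hiff (R z) z).1 rfl
  -- with `u = R x = R₀ p` and `p = x - C u` one has `⟪u, y⟫ = ⟪R₀ p, q⟫ + ⟪u, C v⟫`
  have hform (x y : E) : inner ℝ (R x) y =
      inner ℝ (R₀ (x - C (R x))) (y - C (R y)) + inner ℝ (R x) (C (R y)) := by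
    rw [← hRe x, ← inner_add_right, sub_add_cancel]
  refine ⟨R, (hc.clm_comp C).clm_comp (L.symm : E →L[ℝ] E), fun x y => ?_, fun x => ?_, hiff⟩
  · show inner ℝ (R x) y = inner ℝ x (R y)
    rw [← real_inner_comm x, hform x y, hform y x, hs']
    exact congrArg₂ (· + ·) (real_inner_comm _ _) ((hC' _ _).symm.trans (real_inner_comm _ _))
  · rw [real_inner_comm, hform, real_inner_comm]
    have h1 := hcoer (R x)
    rw [hC'] at h1
    have := hn (x - C (R x))
    nlinarith [mul_nonneg hc0.le (sq_nonneg ‖R x‖)]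

end Resolvent

/-! ### Primitives and weak derivatives -/

section Volterra

theorem intervalIntegrable_L2 (w : L2 ℝ) : IntervalIntegrable w volume 0 1 := by
  rw [intervalIntegrable_iff_integrableOn_Ioo_of_le zero_le_one]
  exact integrableOn_L2 w

theorem intervalIntegrable_L2_sub (w : L2 ℝ) {s t : ℝ} (hs : s ∈ Icc (0 : ℝ) 1)
    (ht : t ∈ Icc (0 : ℝ) 1) : IntervalIntegrable w volume s t :=
  (intervalIntegrable_L2 w).mono_set (by
    rw [uIcc_of_le zero_le_one]
    exact uIcc_subset_Icc hs ht)

/-- The primitive `x ↦ ∫₀ˣ w` of a class `w ∈ L²(0,1)`; it is meaningful for `x ∈ [0,1]`. -/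
def prim (w : L2 ℝ) (x : ℝ) : ℝ := ∫ t in (0 : ℝ)..x, w t

theorem prim_zero_right (w : L2 ℝ) : prim w 0 = 0 := intervalIntegral.integral_same

theorem absolutelyContinuous_prim (w : L2 ℝ) : AbsolutelyContinuousOnInterval (prim w) 0 1 :=
  (intervalIntegrable_L2 w).absolutelyContinuousOnInterval_intervalIntegral (by simp)

theorem continuousOn_prim (w : L2 ℝ) : ContinuousOn (prim w) (Icc 0 1) := by
  simpa [uIcc_of_le zero_le_one] using (absolutelyContinuous_prim w).continuousOn

theorem ae_deriv_prim (w : L2 ℝ) : ∀ᵐ x, x ∈ uIoc (0 : ℝ) 1 → deriv (prim w) x = w x := by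
  filter_upwards [(intervalIntegrable_L2 w).ae_hasDerivAt_integral] with x hx hx'
  exact (hx (uIoc_subset_uIcc hx') 0 (by simp)).deriv

theorem prim_congr {w : L2 ℝ} {g : ℝ → ℝ} (h : w =ᵐ[(volume : Measure ℝ).restrict (Ioo 0 1)] g)
    {x : ℝ} (hx : x ∈ Icc (0 : ℝ) 1) : prim w x = ∫ t in (0 : ℝ)..x, g t := by
  refine intervalIntegral.integral_congr_ae_restrict ?_
  rw [uIoc_of_le hx.1, ← restrict_Ioo_eq_restrict_Ioc]
  exact ae_restrict_of_ae_restrict_of_subset (Ioo_subset_Ioo_right hx.2) h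

theorem prim_add (u v : L2 ℝ) {x : ℝ} (hx : x ∈ Icc (0 : ℝ) 1) :
    prim (u + v) x = prim u x + prim v x := by
  rw [prim_congr (Lp.coeFn_add u v) hx]
  exact intervalIntegral.integral_add (intervalIntegrable_L2_sub u zero_mem_Icc hx)
    (intervalIntegrable_L2_sub v zero_mem_Icc hx)

theorem prim_smul (c : ℝ) (u : L2 ℝ) {x : ℝ} (hx : x ∈ Icc (0 : ℝ) 1) :
    prim (c • u) x = c * prim u x := by
  rw [prim_congr (Lp.coeFn_smul c u) hx]
  exact intervalIntegral.integral_const_mul c _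

theorem prim_neg (u : L2 ℝ) {x : ℝ} (hx : x ∈ Icc (0 : ℝ) 1) : prim (-u) x = -prim u x := by
  simpa using prim_smul (-1) u hx

/-- Integration by parts against a primitive. -/
theorem integral_prim_mul_deriv (w : L2 ℝ) {G : ℝ → ℝ}
    (hG : AbsolutelyContinuousOnInterval G 0 1) :
    ∫ x in (0 : ℝ)..1, prim w x * deriv G x =
      prim w 1 * G 1 - ∫ x in (0 : ℝ)..1, w x * G x := by
  rw [(absolutelyContinuous_prim w).integral_mul_deriv_eq_deriv_mul hG, prim_zero_right, zero_mul,
    sub_zero]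
  congr 1
  refine intervalIntegral.integral_congr_ae ?_
  filter_upwards [ae_deriv_prim w] with x hx hx'
  rw [hx hx']

theorem integral_prim_mul (w v : L2 ℝ) :
    ∫ x in (0 : ℝ)..1, prim w x * v x =
      prim w 1 * prim v 1 - ∫ x in (0 : ℝ)..1, w x * prim v x := by
  rw [← integral_prim_mul_deriv w (absolutelyContinuous_prim v)]
  refine intervalIntegral.integral_congr_ae ?_
  filter_upwards [ae_deriv_prim v] with x hx hx'
  rw [hx hx']

theorem IsContRep.integral_mul {u : L2 ℝ} {g : ℝ → ℝ} (h : IsContRep u g) (f : ℝ → ℝ) :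
    ∫ x in Ioo (0 : ℝ) 1, u x * f x = ∫ x in (0 : ℝ)..1, g x * f x := by
  rw [← setInt_eq]
  refine integral_congr_ae ?_
  filter_upwards [h.2] with x hx
  rw [hx]

theorem IsTestFunction.absolutelyContinuous {φ : ℝ → ℝ} (h : IsTestFunction φ) :
    AbsolutelyContinuousOnInterval φ 0 1 :=
  ContDiffOn.absolutelyContinuousOnInterval (h.smooth.contDiffOn.of_le (by norm_cast))

theorem IsTestFunction.integral_deriv {φ : ℝ → ℝ} (h : IsTestFunction φ) :
    ∫ x in (0 : ℝ)..1, _root_.deriv φ x = 0 := by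
  rw [h.absolutelyContinuous.integral_deriv_eq_sub, h.zero_left, h.zero_right, sub_zero]

/-- A class whose continuous representative is a primitive of `v` has weak derivative `v`. -/
theorem IsContRep.isWeakDeriv {u v : L2 ℝ} {c : ℝ} (h : IsContRep u fun x => c + prim v x) :
    IsWeakDeriv u v := by
  intro φ hφ
  rw [h.integral_mul, setInt_eq]
  simp only [add_mul]
  have hd : IntervalIntegrable (_root_.deriv φ) volume 0 1 :=
    hφ.deriv.smooth.continuous.intervalIntegrable _ _
  rw [intervalIntegral.integral_add (hd.const_mul c), intervalIntegral.integral_const_mul,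
    hφ.integral_deriv, integral_prim_mul_deriv v hφ.absolutelyContinuous, hφ.zero_right]
  · ring
  · refine hd.continuousOn_mul ?_
    rw [uIcc_of_le zero_le_one]
    exact continuousOn_prim v

theorem memLp_of_continuousOn {g : ℝ → ℝ} (hg : ContinuousOn g (Icc 0 1)) :
    MemLp g 2 ((volume : Measure ℝ).restrict (Ioo 0 1)) := by
  obtain ⟨C, hC⟩ := isCompact_Icc.exists_bound_of_continuousOn hg
  refine MemLp.of_bound ((hg.mono Ioo_subset_Icc_self).aestronglyMeasurable measurableSet_Ioo) C ?_
  filter_upwards [ae_restrict_mem measurableSet_Ioo] with x hx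
  exact hC x (Ioo_subset_Icc_self hx)

theorem isContRep_toLp {g : ℝ → ℝ} (hg : ContinuousOn g (Icc 0 1)) :
    IsContRep ((memLp_of_continuousOn hg).toLp g) g :=
  ⟨hg, MemLp.coeFn_toLp _⟩

theorem IsContRep.eq_of_eqOn {u v : L2 ℝ} {g k : ℝ → ℝ} (hu : IsContRep u g)
    (hv : IsContRep v k) (h : EqOn g k (Icc 0 1)) : u = v := by
  apply Lp.ext
  filter_upwards [hu.2, hv.2, ae_restrict_mem measurableSet_Ioo] with x h1 h2 h3
  rw [h1, h2, h (Ioo_subset_Icc_self h3)]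

/-- The lemma of du Bois-Reymond: a class with weak derivative zero is constant. -/
theorem IsWeakDeriv.exists_const {u : L2 ℝ} (h : IsWeakDeriv u 0) :
    ∃ c : ℝ, IsContRep u fun _ => c := by
  obtain ⟨ψ, hψ, hψ1⟩ := exists_unit_test
  have h0 (φ : ℝ → ℝ) (hφ : IsTestFunction φ) :
      ∫ x in Ioo (0 : ℝ) 1, u x * _root_.deriv φ x = 0 := by
    rw [h φ hφ, isContRep_zero.integral_mul]
    simp
  set c : ℝ := ∫ x in Ioo (0 : ℝ) 1, u x * ψ x with hc
  refine ⟨c, continuousOn_const, ?_⟩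
  have key := ae_zero_of_test (f := fun x => u x - c)
    ((integrableOn_L2 u).sub (integrableOn_const (by simp))) (by
      intro η hη
      set I : ℝ := ∫ x in (0 : ℝ)..1, η x with hI
      -- `η - (∫ η) ψ` has integral zero, so it is the derivative of a test function
      have hθ : IsTestFunction (fun x => η x - I * ψ x) := by
        have hsupp : Function.support (fun x => η x - I * ψ x) ⊆ tsupport η ∪ tsupport ψ := by
          intro x hx
          by_contra hn
          rw [mem_union, not_or] at hn
          apply hx
          simp [image_eq_zero_of_notMem_tsupport hn.1, image_eq_zero_of_notMem_tsupport hn.2]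
        have hcl : IsCompact (tsupport η ∪ tsupport ψ) :=
          IsCompact.union hη.compact hψ.compact
        exact ⟨hη.smooth.sub (contDiff_const.mul hψ.smooth),
          HasCompactSupport.of_support_subset_isCompact hcl hsupp,
          (closure_minimal hsupp hcl.isClosed).trans (union_subset hη.supp hψ.supp)⟩
      obtain ⟨φ, hφ, hφd⟩ := hθ.exists_antideriv (by
        rw [intervalIntegral.integral_sub (hη.smooth.continuous.intervalIntegrable _ _)
          ((hψ.smooth.continuous.intervalIntegrable _ _).const_mul I),
          intervalIntegral.integral_const_mul, hψ1, mul_one, hI, sub_self])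
      have hη' : IntegrableOn η (Ioo 0 1) :=
        (hη.smooth.continuous.integrableOn_Icc).mono_set Ioo_subset_Icc_self
      have h1 := h0 φ hφ
      rw [hφd] at h1
      simp only [mul_sub, mul_left_comm _ I] at h1
      rw [integral_sub (integrable_mul_cont u hη.continuousOn)
        ((integrable_mul_cont u hψ.continuousOn).const_mul I), integral_const_mul, ← hc] at h1
      simp only [sub_mul]
      rw [integral_sub (integrable_mul_cont u hη.continuousOn) (hη'.const_mul c),
        integral_const_mul, setInt_eq η, ← hI]
      linarith)
  filter_upwards [key] with x hx
  have : u x - c = 0 := hx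
  linarith

/-- The class of `x ↦ ∫₀ˣ w`. -/
def primL2 (w : L2 ℝ) : L2 ℝ := (memLp_of_continuousOn (continuousOn_prim w)).toLp (prim w)

theorem isContRep_primL2 (w : L2 ℝ) : IsContRep (primL2 w) (prim w) :=
  isContRep_toLp (continuousOn_prim w)

/-- A class with weak derivative `v` is a primitive of `v`. -/
theorem IsWeakDeriv.exists_contRep_prim {u v : L2 ℝ} (h : IsWeakDeriv u v) :
    ∃ c : ℝ, IsContRep u fun x => c + prim v x := by
  have h1 : IsWeakDeriv (primL2 v) v :=
    IsContRep.isWeakDeriv (c := 0) (by simpa using isContRep_primL2 v)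
  have h2 : IsWeakDeriv (u + (-1 : ℝ) • primL2 v) 0 := by
    have := h.add (h1.smul (-1))
    rwa [neg_one_smul ℝ v, add_neg_cancel] at this
  obtain ⟨c, hc⟩ := h2.exists_const
  refine ⟨c, ?_⟩
  have := hc.add (isContRep_primL2 v)
  rwa [neg_one_smul, neg_add_cancel_right] at this

/-- Cauchy–Schwarz for an integral over a subinterval. -/
theorem abs_prim_sub_le (w : L2 ℝ) {s t : ℝ} (hs : 0 ≤ s) (hst : s ≤ t) (ht : t ≤ 1) :
    |prim w t - prim w s| ≤ √(t - s) * ‖w‖ := by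
  have hI : prim w t - prim w s = ∫ x in Ioo s t, w x := by
    rw [prim, prim, intervalIntegral.integral_interval_sub_left
      (intervalIntegrable_L2_sub w zero_mem_Icc ⟨hs.trans hst, ht⟩)
      (intervalIntegrable_L2_sub w zero_mem_Icc ⟨hs, hst.trans ht⟩),
      intervalIntegral.integral_of_le hst, integral_Ioc_eq_integral_Ioo]
  have hsub : Ioo s t ∩ Ioo 0 1 = Ioo s t :=
    inter_eq_left.2 (Ioo_subset_Ioo hs ht)
  have hfin : ((volume : Measure ℝ).restrict (Ioo 0 1)) (Ioo s t) ≠ ⊤ := measure_ne_top _ _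
  have hin := L2.inner_indicatorConstLp_one (𝕜 := ℝ) (measurableSet_Ioo (a := s) (b := t)) hfin w
  rw [Measure.restrict_restrict measurableSet_Ioo, hsub, ← hI] at hin
  rw [← hin]
  refine (abs_real_inner_le_norm _ _).trans (mul_le_mul_of_nonneg_right ?_ (norm_nonneg _))
  rw [norm_indicatorConstLp (by norm_num) (by norm_num), measureReal_restrict_apply measurableSet_Ioo,
    hsub, Real.volume_real_Ioo_of_le hst, Real.sqrt_eq_rpow]
  simp

theorem abs_prim_sub_le' (w : L2 ℝ) {s t : ℝ} (hs : s ∈ Icc (0 : ℝ) 1) (ht : t ∈ Icc (0 : ℝ) 1) :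
    |prim w s - prim w t| ≤ √|s - t| * ‖w‖ := by
  rcases le_total s t with h | h
  · rw [abs_sub_comm, abs_sub_comm s, abs_of_nonneg (sub_nonneg.2 h)]
    exact abs_prim_sub_le w hs.1 h ht.2
  · rw [abs_of_nonneg (sub_nonneg.2 h)]
    exact abs_prim_sub_le w ht.1 h hs.2

theorem abs_prim_le (w : L2 ℝ) {x : ℝ} (hx : x ∈ Icc (0 : ℝ) 1) : |prim w x| ≤ ‖w‖ := by
  have h := abs_prim_sub_le w le_rfl hx.1 hx.2
  rw [prim_zero_right, sub_zero, sub_zero] at h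
  exact h.trans (mul_le_of_le_one_left (norm_nonneg _) (Real.sqrt_le_one.2 hx.2))

open scoped BoundedContinuousFunction

/-- The Volterra operator `w ↦ ∫₀ˣ w` from `L²(0,1)` to the continuous functions on `[0,1]`. -/
def volterra : L2 ℝ →L[ℝ] (Icc (0 : ℝ) 1 →ᵇ ℝ) :=
  LinearMap.mkContinuous
    { toFun := fun w => BoundedContinuousFunction.mkOfCompact
        ⟨fun x => prim w x, continuousOn_iff_continuous_domRestrict.1 (continuousOn_prim w)⟩
      map_add' := fun u v => by
        ext x
        exact prim_add u v x.2
      map_smul' := fun c u => by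
        ext x
        exact prim_smul c u x.2 } 1 fun w => by
    rw [one_mul, BoundedContinuousFunction.norm_le (norm_nonneg _)]
    exact fun x => abs_prim_le w x.2

theorem volterra_apply (w : L2 ℝ) (x : Icc (0 : ℝ) 1) : volterra w x = prim w x := rfl

/-- The primitives of the unit ball of `L²(0,1)` are uniformly bounded and Hölder continuous with
exponent `1/2`, so that the theorem of Arzelà–Ascoli applies. -/
theorem isCompactOperator_volterra : IsCompactOperator volterra := by
  refine (isCompactOperator_iff_isCompact_closure_image_closedBall
    volterra.toLinearMap one_pos).2 ?_
  refine BoundedContinuousFunction.arzela_ascoli (Metric.closedBall 0 1)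
    (isCompact_closedBall _ _) _ ?_ ?_
  · rintro _ x ⟨w, hw, rfl⟩
    rw [mem_closedBall_zero_iff] at hw ⊢
    exact (abs_prim_le w x.2).trans hw
  · refine Metric.equicontinuous_of_continuity_modulus (fun r => √r) ?_ _ ?_
    · simpa using Real.continuous_sqrt.tendsto 0
    · rintro x y ⟨_, w, hw, rfl⟩
      rw [mem_closedBall_zero_iff] at hw
      exact (abs_prim_sub_le' w x.2 y.2).trans
        (mul_le_of_le_one_right (Real.sqrt_nonneg _) hw)

end Volterra

/-! ### The resolvent of the Wentzell operator -/

section Concrete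

open scoped BoundedContinuousFunction

variable {a d : ℝ}

theorem continuousOn_extend (g : Icc (0 : ℝ) 1 →ᵇ ℝ) :
    ContinuousOn (fun x => g (projIcc 0 1 zero_le_one x)) (Icc 0 1) :=
  (g.continuous.comp continuous_projIcc).continuousOn

variable [Fact (0 < a * d)]

theorem norm_le_of_component_le {U : StateSpace a d ℝ} {M : ℝ} (hM : 0 ≤ M) (h₁ : ‖U.fst‖ ≤ M)
    (h₂ : |U.snd| ≤ M) : ‖U‖ ≤ √(1 + a / d) * M := by
  have hw := StateSpace.weight_pos a d
  refine le_of_sq_le_sq ?_ (by positivity)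
  rw [StateSpace.norm_sq_eq, mul_pow, Real.sq_sqrt (by linarith), Real.norm_eq_abs]
  have e1 := pow_le_pow_left₀ (norm_nonneg _) h₁ 2
  have e2 := pow_le_pow_left₀ (abs_nonneg _) h₂ 2
  nlinarith

/-- The bounded map `g ↦ (g, g(1))` from the continuous functions on `[0,1]` to `H`. -/
def ofCont (a d : ℝ) [Fact (0 < a * d)] : (Icc (0 : ℝ) 1 →ᵇ ℝ) →L[ℝ] StateSpace a d ℝ :=
  LinearMap.mkContinuous
    { toFun := fun g =>
        ⟨(memLp_of_continuousOn (continuousOn_extend g)).toLp _, g ⟨1, one_mem_Icc⟩⟩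
      map_add' := fun _ _ => rfl
      map_smul' := fun _ _ => rfl } √(1 + a / d) fun g => by
    refine norm_le_of_component_le (norm_nonneg g) ?_ (g.norm_coe_le_norm _)
    refine (Lp.norm_le_of_ae_bound (norm_nonneg g) ?_).trans ?_
    · filter_upwards [MemLp.coeFn_toLp (memLp_of_continuousOn (continuousOn_extend g))] with x hx
      exact (congrArg norm hx).trans_le (g.norm_coe_le_norm _)
    · simp [measureUnivNNReal]

/-- `J w = (u, u(1))` with `u(x) = ∫₀ˣ w`. -/
def J (a d : ℝ) [Fact (0 < a * d)] : L2 ℝ →L[ℝ] StateSpace a d ℝ := ofCont a d ∘L volterra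

theorem J_snd (w : L2 ℝ) : (J a d w).snd = prim w 1 := rfl

theorem J_fst (w : L2 ℝ) : (J a d w).fst = primL2 w := by
  refine IsContRep.eq_of_eqOn (isContRep_toLp (continuousOn_extend (volterra w)))
    (isContRep_primL2 w) fun x hx => ?_
  simp only [volterra_apply, projIcc_of_mem _ hx]

theorem isCompactOperator_J : IsCompactOperator (J a d) :=
  isCompactOperator_volterra.clm_comp (ofCont a d)

theorem inner_eq_integral (u v : L2 ℝ) : inner ℝ u v = ∫ x in Ioo (0 : ℝ) 1, u x * v x := by
  rw [L2.inner_def]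
  simp [mul_comm]

/-- The adjoint of `J` maps `(f, f₁)` to `x ↦ ∫ₓ¹ f + (a/d) f₁`. -/
theorem isContRep_adjoint_J (F : StateSpace a d ℝ) :
    IsContRep ((J a d).adjoint F) fun x => prim F.fst 1 + a / d * F.snd - prim F.fst x := by
  set k : ℝ := prim F.fst 1 + a / d * F.snd with hk
  have hc : ContinuousOn (fun x => k - prim F.fst x) (Icc 0 1) :=
    continuousOn_const.sub (continuousOn_prim _)
  suffices h : (J a d).adjoint F = (memLp_of_continuousOn hc).toLp _ by
    rw [h]
    exact isContRep_toLp hc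
  refine ext_inner_left ℝ fun w => ?_
  rw [ContinuousLinearMap.adjoint_inner_right, StateSpace.inner_def, J_fst, J_snd,
    inner_eq_integral, inner_eq_integral, (isContRep_primL2 w).integral_mul, integral_prim_mul]
  have h1 : ∫ x in Ioo (0 : ℝ) 1, w x * (memLp_of_continuousOn hc).toLp _ x =
      ∫ x in (0 : ℝ)..1, (k * w x - w x * prim F.fst x) := by
    rw [← setInt_eq]
    refine integral_congr_ae ?_
    filter_upwards [(isContRep_toLp hc).2] with x hx
    rw [hx]
    ring
  have h2 : IntervalIntegrable (fun x => w x * prim F.fst x) volume 0 1 := by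
    refine (intervalIntegrable_L2 w).mul_continuousOn ?_
    rw [uIcc_of_le zero_le_one]
    exact continuousOn_prim _
  rw [h1, intervalIntegral.integral_sub ((intervalIntegrable_L2 w).const_mul k) h2,
    intervalIntegral.integral_const_mul, hk]
  simp only [RCLike.inner_apply, conj_trivial, RCLike.ofReal_real_eq_id, id]
  change _ = (prim F.fst 1 + a / d * F.snd) * prim w 1 - _
  ring

/-- The compact nonnegative operator `J J†`, the inverse of `(u, u₁) ↦ (-u'', (d/a) u'(1))`. -/
def R₀ (a d : ℝ) [Fact (0 < a * d)] : StateSpace a d ℝ →L[ℝ] StateSpace a d ℝ :=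
  J a d ∘L (J a d).adjoint

theorem isCompactOperator_R₀ : IsCompactOperator (R₀ a d) :=
  isCompactOperator_J.comp_clm _

theorem inner_R₀ (U V : StateSpace a d ℝ) :
    inner ℝ U (R₀ a d V) = inner ℝ ((J a d).adjoint U) ((J a d).adjoint V) := by
  rw [ContinuousLinearMap.adjoint_inner_left]
  rfl

theorem isSymmetric_R₀ : (R₀ a d).IsSymmetric := fun U V => by
  show inner ℝ (R₀ a d U) V = inner ℝ U (R₀ a d V)
  rw [← real_inner_comm, inner_R₀, inner_R₀, real_inner_comm]

theorem inner_R₀_nonneg (U : StateSpace a d ℝ) : 0 ≤ inner ℝ U (R₀ a d U) := by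
  rw [inner_R₀]
  exact real_inner_self_nonneg

/-- The bounded part `(u, u₁) ↦ (0, (b/a) u₁)` of the operator. -/
def boundaryOp (a b d : ℝ) [Fact (0 < a * d)] : StateSpace a d ℝ →L[ℝ] StateSpace a d ℝ :=
  LinearMap.mkContinuous
    { toFun := fun U => ⟨0, b / a * U.snd⟩
      map_add' := fun U V => by ext1 <;> simp [mul_add]
      map_smul' := fun c U => by ext1 <;> simp [mul_left_comm] } |b / a| fun U => by
    have hw := StateSpace.weight_pos a d
    refine le_of_sq_le_sq ?_ (by positivity)
    rw [StateSpace.norm_sq_eq, mul_pow, StateSpace.norm_sq_eq]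
    show ‖(0 : L2 ℝ)‖ ^ 2 + a / d * ‖b / a * U.snd‖ ^ 2 ≤ _
    rw [norm_zero, norm_mul, Real.norm_eq_abs (b / a), mul_pow]
    nlinarith [sq_nonneg (|b / a| * ‖U.fst‖)]

theorem boundaryOp_fst (b : ℝ) (U : StateSpace a d ℝ) : (boundaryOp a b d U).fst = 0 := rfl

theorem boundaryOp_snd (b : ℝ) (U : StateSpace a d ℝ) :
    (boundaryOp a b d U).snd = b / a * U.snd := rfl

theorem norm_boundaryOp_le (b : ℝ) (U : StateSpace a d ℝ) :
    ‖boundaryOp a b d U‖ ≤ |b / a| * ‖U‖ :=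
  (ContinuousLinearMap.le_opNorm _ _).trans (mul_le_mul_of_nonneg_right
    (LinearMap.mkContinuous_norm_le _ (abs_nonneg _) _) (norm_nonneg _))

theorem isSymmetric_boundaryOp (b : ℝ) : (boundaryOp a b d).IsSymmetric := fun U V => by
  show inner ℝ (boundaryOp a b d U) V = inner ℝ U (boundaryOp a b d V)
  simp only [StateSpace.inner_def, boundaryOp_fst, boundaryOp_snd, inner_zero_left,
    inner_zero_right, RCLike.inner_apply, conj_trivial]
  ring

/-- The operator as a bounded perturbation of `-R₀⁻¹`: this turns the differential equation with
its boundary conditions into an integral equation. -/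
theorem mem_graph_iff (b : ℝ) (U V : StateSpace a d ℝ) :
    (U, V) ∈ (wentzellOperator a b d).graph ↔ U = R₀ a d (boundaryOp a b d U - V) := by
  have had : a * d ≠ 0 := (Fact.out : 0 < a * d).ne'
  have ha : a ≠ 0 := left_ne_zero_of_mul had
  have hd : d ≠ 0 := right_ne_zero_of_mul had
  set Z := boundaryOp a b d U - V with hZ
  have hZ1 : Z.fst = -V.fst := by
    have : Z.fst = (boundaryOp a b d U).fst - V.fst := by
      rw [eq_sub_iff_add_eq, ← StateSpace.add_fst, hZ, sub_add_cancel]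
    rw [this, boundaryOp_fst, zero_sub]
  have hZ2 : Z.snd = b / a * U.snd - V.snd := by
    rw [eq_sub_iff_add_eq, ← StateSpace.add_snd, hZ, sub_add_cancel, boundaryOp_snd]
  set k : ℝ := a / d * Z.snd - prim V.fst 1 with hk
  have hw : IsContRep ((J a d).adjoint Z) fun x => k + prim V.fst x := by
    have := isContRep_adjoint_J Z
    refine ⟨continuousOn_const.add (continuousOn_prim _), this.2.trans ?_⟩
    filter_upwards [ae_restrict_mem measurableSet_Ioo] with x hx
    rw [hZ1, prim_neg _ one_mem_Icc, prim_neg _ (Ioo_subset_Icc_self hx), hk]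
    ring
  constructor
  · intro h
    obtain ⟨⟨U', hU'⟩, hUU, hV⟩ := LinearPMap.mem_graph_iff _ |>.1 h
    obtain rfl : U' = U := hUU
    obtain ⟨⟨w, hUw, v, hwv⟩, h1, h0⟩ := hU'
    have hV1 : v = V.fst := by
      rw [← hwv.weakDeriv_eq, ← hUw.weakDeriv_eq]
      exact congrArg StateSpace.fst hV
    have hV2 : -(d / a) * valueAt w 1 + b / a * U'.snd = V.snd := by
      rw [← hUw.weakDeriv_eq]
      exact congrArg StateSpace.snd hV
    subst hV1
    obtain ⟨c, hc⟩ := hwv.exists_contRep_prim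
    obtain ⟨c', hc'⟩ := hUw.exists_contRep_prim
    rw [hc'.valueAt_eq zero_mem_Icc, prim_zero_right, add_zero] at h0
    rw [hc'.valueAt_eq one_mem_Icc] at h1
    subst h0
    have hwJ : (J a d).adjoint Z = w := by
      refine hw.eq_of_eqOn hc fun x _ => ?_
      rw [hc.valueAt_eq one_mem_Icc] at hV2
      have : k = c := by
        rw [hk, hZ2, ← hV2]
        field_simp
        ring
      rw [this]
    show U' = J a d ((J a d).adjoint Z)
    rw [hwJ]
    ext1
    · rw [J_fst]
      exact hc'.eq_of_eqOn (isContRep_primL2 w) fun x _ => zero_add _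
    · rw [J_snd, ← h1, zero_add]
  · intro h
    set w := (J a d).adjoint Z with hwdef
    have hU : U = J a d w := h
    have hU1 : U.fst = primL2 w := by rw [hU, J_fst]
    have hU2 : U.snd = prim w 1 := by rw [hU, J_snd]
    have hrep : IsContRep U.fst (prim w) := hU1 ▸ isContRep_primL2 w
    have hd1 : IsWeakDeriv U.fst w := IsContRep.isWeakDeriv (c := 0) (by simpa using hrep)
    have hd2 : IsWeakDeriv w V.fst := hw.isWeakDeriv
    rw [LinearPMap.mem_graph_iff]
    refine ⟨⟨U, ⟨w, hd1, _, hd2⟩, ?_, ?_⟩, rfl, ?_⟩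
    · rw [hrep.valueAt_eq one_mem_Icc, hU2]
    · rw [hrep.valueAt_eq zero_mem_Icc, prim_zero_right]
    · ext1
      · show weakDeriv (weakDeriv U.fst) = V.fst
        rw [hd1.weakDeriv_eq, hd2.weakDeriv_eq]
      · show -(d / a) * valueAt (weakDeriv U.fst) 1 + b / a * U.snd = V.snd
        rw [hd1.weakDeriv_eq, hw.valueAt_eq one_mem_Icc, hk, hZ2]
        field_simp
        ring

/-- `ω - 𝒜` with `ω = |b/a| + 1` has a compact, symmetric, nonnegative inverse. -/
theorem exists_resolvent (a b d : ℝ) [Fact (0 < a * d)] :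
    ∃ R : StateSpace a d ℝ →L[ℝ] StateSpace a d ℝ, IsCompactOperator R ∧ R.IsSymmetric ∧
      (∀ U, 0 ≤ inner ℝ U (R U)) ∧
      ∀ U V, (U, V) ∈ (wentzellOperator a b d).graph ↔ U = R ((|b / a| + 1) • U - V) := by
  have hB := isSymmetric_boundaryOp (a := a) (d := d) b
  obtain ⟨R, h1, h2, h3, h4⟩ := exists_perturbed_resolvent (R₀ := R₀ a d)
    (C := (|b / a| + 1) • (1 : StateSpace a d ℝ →L[ℝ] StateSpace a d ℝ) - boundaryOp a b d)
    isCompactOperator_R₀ isSymmetric_R₀ inner_R₀_nonneg (fun U V => by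
      show inner ℝ ((|b / a| + 1) • U - boundaryOp a b d U) V =
        inner ℝ U ((|b / a| + 1) • V - boundaryOp a b d V)
      have : inner ℝ (boundaryOp a b d U) V = inner ℝ U (boundaryOp a b d V) := hB U V
      rw [inner_sub_left, inner_sub_right, real_inner_smul_left, real_inner_smul_right, this])
    one_pos (fun U => by
      show 1 * ‖U‖ ^ 2 ≤ inner ℝ ((|b / a| + 1) • U - boundaryOp a b d U) U
      rw [inner_sub_left, real_inner_smul_left, real_inner_self_eq_norm_sq]
      have e1 := real_inner_le_norm (boundaryOp a b d U) U
      have e2 := mul_le_mul_of_nonneg_right (norm_boundaryOp_le b U) (norm_nonneg U)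
      nlinarith)
  refine ⟨R, h1, h2, h3, fun U V => ?_⟩
  rw [h4, mem_graph_iff]
  have : (|b / a| + 1) • U - V -
      ((|b / a| + 1) • (1 : StateSpace a d ℝ →L[ℝ] StateSpace a d ℝ) - boundaryOp a b d) U =
      boundaryOp a b d U - V := by
    show (|b / a| + 1) • U - V - ((|b / a| + 1) • U - boundaryOp a b d U) = _
    abel
  rw [this]

end Concrete

/-! ### Complexification -/

section Complexification

variable {a d : ℝ}

theorem inner_ofReal_compLp (u v : L2 ℝ) :
    inner ℂ (Complex.ofRealCLM.compLp u : L2 ℂ) (Complex.ofRealCLM.compLp v) =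
      ((inner ℝ u v : ℝ) : ℂ) := by
  rw [L2.inner_def, L2.inner_def, ← integral_complex_ofReal]
  refine integral_congr_ae ?_
  filter_upwards [Complex.ofRealCLM.coeFn_compLp u, Complex.ofRealCLM.coeFn_compLp v]
    with x h1 h2
  rw [h1, h2]
  simp

/-- The real part of an element of the complexified state space. -/
def realPart (U : StateSpace a d ℂ) : StateSpace a d ℝ :=
  ⟨Complex.reCLM.compLp U.fst, U.snd.re⟩

/-- The imaginary part of an element of the complexified state space. -/
def imagPart (U : StateSpace a d ℂ) : StateSpace a d ℝ :=
  ⟨Complex.imCLM.compLp U.fst, U.snd.im⟩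

theorem complexify_add_I_smul (U : StateSpace a d ℂ) :
    complexify (realPart U) + Complex.I • complexify (imagPart U) = U := by
  ext1
  · apply Lp.ext
    simp only [StateSpace.add_fst, StateSpace.smul_fst, complexify, realPart, imagPart]
    filter_upwards [Lp.coeFn_add (Complex.ofRealCLM.compLp (Complex.reCLM.compLp U.fst) : L2 ℂ)
        (Complex.I • Complex.ofRealCLM.compLp (Complex.imCLM.compLp U.fst) : L2 ℂ),
      Lp.coeFn_smul Complex.I (Complex.ofRealCLM.compLp (Complex.imCLM.compLp U.fst) : L2 ℂ),
      Complex.ofRealCLM.coeFn_compLp (Complex.reCLM.compLp U.fst),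
      Complex.ofRealCLM.coeFn_compLp (Complex.imCLM.compLp U.fst),
      Complex.reCLM.coeFn_compLp U.fst, Complex.imCLM.coeFn_compLp U.fst] with x h1 h2 h3 h4 h5 h6
    rw [h1, Pi.add_apply, h2, Pi.smul_apply, h3, h4, h5, h6]
    simp only [Complex.ofRealCLM_apply, Complex.reCLM_apply, Complex.imCLM_apply, smul_eq_mul]
    rw [mul_comm]
    exact Complex.re_add_im _
  · simp only [StateSpace.add_snd, StateSpace.smul_snd, complexify, realPart, imagPart]
    rw [mul_comm]
    exact Complex.re_add_im _

theorem complexify_zero : complexify (0 : StateSpace a d ℝ) = 0 := by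
  ext1
  · exact (Complex.ofRealCLM.compLpₗ 2 _).map_zero
  · exact Complex.ofReal_zero

theorem inner_complexify (U V : StateSpace a d ℝ) :
    inner ℂ (complexify U) (complexify V) = ((inner ℝ U V : ℝ) : ℂ) := by
  rw [StateSpace.inner_def, StateSpace.inner_def]
  simp only [complexify, inner_ofReal_compLp]
  simp

variable [Fact (0 < a * d)]

variable {ι : Type*} (e : HilbertBasis ι ℝ (StateSpace a d ℝ))

theorem orthonormal_complexify : Orthonormal ℂ fun i => complexify (e i) := by
  classical
  rw [orthonormal_iff_ite]
  intro i j
  rw [inner_complexify, orthonormal_iff_ite.1 e.orthonormal]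
  split_ifs <;> simp

theorem orthogonal_span_complexify :
    (Submodule.span ℂ (range fun i => complexify (e i)))ᗮ = ⊥ := by
  rw [eq_bot_iff]
  intro U hU
  rw [Submodule.mem_orthogonal] at hU
  have key (i : ι) : inner ℝ (e i) (realPart U) = 0 ∧ inner ℝ (e i) (imagPart U) = 0 := by
    have h := hU _ (Submodule.subset_span ⟨i, rfl⟩)
    rw [← complexify_add_I_smul U, inner_add_right, inner_smul_right, inner_complexify,
      inner_complexify] at h
    have h1 := congrArg Complex.re h
    have h2 := congrArg Complex.im h
    simp only [Complex.add_re, Complex.add_im, Complex.mul_re, Complex.mul_im, Complex.I_re,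
      Complex.I_im, Complex.ofReal_re, Complex.ofReal_im, Complex.zero_re, Complex.zero_im] at h1 h2
    constructor <;> linarith
  have h1 : realPart U = 0 := eq_of_repr e fun i => by
    rw [e.repr_apply_apply, (key i).1, map_zero]
    rfl
  have h2 : imagPart U = 0 := eq_of_repr e fun i => by
    rw [e.repr_apply_apply, (key i).2, map_zero]
    rfl
  rw [Submodule.mem_bot, ← complexify_add_I_smul U, h1, h2, complexify_zero, smul_zero, add_zero]

/-- A Hilbert basis of the real state space is one of its complexification. -/
def complexBasis : HilbertBasis ι ℂ (StateSpace a d ℂ) :=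
  HilbertBasis.mkOfOrthogonalEqBot (orthonormal_complexify e) (orthogonal_span_complexify e)

theorem complexBasis_repr_complexify (U : StateSpace a d ℝ) (i : ι) :
    (complexBasis e).repr (complexify U) i = (e.repr U i : ℝ) := by
  rw [HilbertBasis.repr_apply_apply, complexBasis, HilbertBasis.coe_mkOfOrthogonalEqBot,
    inner_complexify, e.repr_apply_apply]

theorem isAnalyticOfAngle_expSemigroup {lam : ι → ℝ} {ω : ℝ} (hl : ∀ i, lam i ≤ ω) :
    IsAnalyticOfAngle (Real.pi / 2) (expSemigroup e lam) := by
  refine ⟨cexpSemigroup (complexBasis e) lam, isAnalyticSemigroup_cexpSemigroup _ hl,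
    fun t ht U => eq_of_repr (complexBasis e) fun i => ?_⟩
  rw [repr_cexpSemigroup _ hl (by simpa using ht), complexBasis_repr_complexify,
    complexBasis_repr_complexify, repr_expSemigroup e hl ht]
  push_cast
  rfl

end Complexification

end
end Wentzell

theorem mainTheorem3 (a b d : ℝ) [Fact (0 < a * d)] :
    Dense ((Wentzell.wentzellOperator a b d).domain : Set (Wentzell.StateSpace a d ℝ)) ∧
    IsSelfAdjoint (Wentzell.wentzellOperator a b d) ∧
    ∃ T : ℝ → Wentzell.StateSpace a d ℝ →L[ℝ] Wentzell.StateSpace a d ℝ,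
      Wentzell.IsC0Semigroup T ∧
      Wentzell.IsGenerator (Wentzell.wentzellOperator a b d) T ∧
      (∀ t : ℝ, 0 < t → IsCompactOperator (T t)) ∧
      Wentzell.IsAnalyticOfAngle (Real.pi / 2) T := by
  obtain ⟨R, hc, hs, hn, hR⟩ := Wentzell.exists_resolvent a b d
  obtain ⟨ι, e, lam, hl, hA, hRe⟩ := Wentzell.exists_hilbertBasis_of_resolvent hc hs hn hR
  exact ⟨Wentzell.dense_domain_of_diagonal e hA, Wentzell.isSelfAdjoint_of_diagonal e hA,
    Wentzell.expSemigroup e lam, Wentzell.isC0Semigroup_expSemigroup e hl,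
    Wentzell.isGenerator_expSemigroup e hl _ hA,
    fun _ ht => Wentzell.isCompactOperator_expSemigroup e hc hl hRe ht,
    Wentzell.isAnalyticOfAngle_expSemigroup e hl⟩
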